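/- Let $k\ge 1$ and let $(X,x)$ be a pointed topological space. $\mathrm{HPol}_*$ denotes the full subcategory of the pointed homotopy category $\mathrm{HTop}_*$ on the pointed spaces that have the pointed homotopy type of a polyhedron. An $\mathrm{HPol}_*$-expansion $\mathbf p=(p_\lambda):(X,x)\to((X_\lambda,x_\lambda),p_{\lambda\lambda'},\Lambda)$ is a morphism of pro-$\mathrm{HTop}_*$ to an inverse system in $\mathrm{HPol}_*$ over a directed set such that (E1) every morphism from $(X,x)$ to an object $P$ of $\mathrm{HPol}_*$ factors through some $p_\lambda$, and (E2) if $f_0p_\lambda=f_1p_\lambda$ for $f_0,f_1:X_\lambda\to P$ with $P$ in $\mathrm{HPol}_*$, then $f_0p_{\lambda\lambda'}=f_1p_{\lambda\lambda'}$ for some $\lambda'\ge\lambda$. Let $\check\pi_k^{*}(X,x)$ be the $k$-th coarse shape homotopy group, i.e. the set of coarse shape morphisms $F^*=\langle[(f^n_\lambda)]\rangle:(S^k,*)\to(X,x)$, represented over an expansion $\mathbf p$ by morphisms of pro$^*$-$\mathrm{HPol}_*$: sequences $(f^n_\lambda)_{n\in\mathbb N}$ of pointed homotopy classes $(S^k,*)\to(X_\lambda,x_\lambda)$,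 one for each $\lambda\in\Lambda$, such that for all $\lambda\le\lambda'$ one has $p_{\lambda\lambda'}f^n_{\lambda'}=f^n_\lambda$ for all large $n$; two such families are identified if for each $\lambda$ they agree for all large $n$, and the representatives over different expansions of $(X,x)$ are identified along the canonical isomorphisms between the expansions. The group operation is $\langle[(f^n_\lambda)]\rangle+\langle[(g^n_\lambda)]\rangle=\langle[(f^n_\lambda+g^n_\lambda)]\rangle$. Let $\check\pi_k^{*top}(X,x)$ be this group with the topology that has the sets $V_\lambda^{F^*}=\{G^*: p_\lambda\circ G^*=p_\lambda\circ F^*\}$ as a basis (this does not depend on the expansion). Then, for every $\mathrm{HPol}_*$-expansion $\mathbf p:(X,x)\to((X_\lambda,x_\lambda),p_{\lambda\lambda'},\Lambda)$, all the groups $\check\pi_k^{*top}(X_\lambda,x_\lambda)$ are discrete, and the map $F^*\mapsto(p_\lambda\circ F^*)_{\lambda}$ is an isomorphism of topological groups $$\check\pi_k^{*top}(X,x)\;\cong\;\varprojlim_{\lambda\in\Lambda}\check\pi_k^{*top}(X_\lambda,x_\lambda),$$ where the inverse limit is taken along the homomorphisms induced by the $p_{\lambda\lambda'}$. Consequently,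 for every pointed topological space $(X,x)$, the topological group $\check\pi_k^{*top}(X,x)$ is prodiscrete (isomorphic as a topological group to the inverse limit of an inverse system of discrete groups over a directed set) and Hausdorff. -/

import Mathlib

open CategoryTheory Topology
open scoped Topology.Homotopy unitInterval

universe u v

/-! ## The pointed homotopy category -/

/-- Pointed topological spaces; the objects of the pointed homotopy category `HTop_*`. -/
structure PtdSpace : Type (u + 1) where
  carrier : Type u
  [top : TopologicalSpace carrier]
  pt : carrier

namespace PtdSpace

instance : CoeSort PtdSpace.{u} (Type u) := ⟨PtdSpace.carrier⟩

instance (X : PtdSpace.{u}) : TopologicalSpace X := X.top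

/-- Continuous base point preserving maps. -/
def Map (X Y : PtdSpace.{u}) : Type u := {f : C(X, Y) // f X.pt = Y.pt}

/-- Homotopy of pointed maps, relative to the base point. -/
instance mapSetoid (X Y : PtdSpace.{u}) : Setoid (Map X Y) where
  r f g := f.1.HomotopicRel g.1 {X.pt}
  iseqv := ⟨fun f => .refl f.1, fun h => h.symm, fun h h' => h.trans h'⟩

def Map.comp {X Y Z : PtdSpace.{u}} (f : Map X Y) (g : Map Y Z) : Map X Z :=
  ⟨g.1.comp f.1, by simp [f.2, g.2]⟩

theorem Map.comp_congr {X Y Z : PtdSpace.{u}} {f f' : Map X Y} {g g' : Map Y Z}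
    (hf : f ≈ f') (hg : g ≈ g') : f.comp g ≈ f'.comp g' := by
  obtain ⟨G⟩ := hg
  have h₁ : (g.1.comp f.1).HomotopicRel (g.1.comp f'.1) {X.pt} := hf.comp_continuousMap g.1
  refine h₁.trans ⟨⟨⟨⟨fun z => G (z.1, f'.1 z.2), by fun_prop⟩, ?_, ?_⟩, ?_⟩⟩
  · intro x; exact G.apply_zero _
  · intro x; exact G.apply_one _
  · intro t x hx
    have hx' : f'.1 x = Y.pt := by rw [Set.mem_singleton_iff.1 hx]; exact f'.2
    change G (t, f'.1 x) = g.1 (f'.1 x)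
    exact G.eq_fst t (by rw [hx']; rfl)

/-- The pointed homotopy category `HTop_*`: morphisms are pointed homotopy classes of
pointed maps. -/
instance : Category PtdSpace.{u} where
  Hom X Y := Quotient (mapSetoid X Y)
  id X := ⟦⟨ContinuousMap.id X, rfl⟩⟧
  comp f g := Quotient.map₂ Map.comp (fun _ _ h _ _ h' => Map.comp_congr h h') f g
  id_comp := by rintro X Y ⟨f⟩; rfl
  comp_id := by rintro X Y ⟨f⟩; rfl
  assoc := by rintro W X Y Z ⟨f⟩ ⟨g⟩ ⟨h⟩; rfl

/-- The homotopy class of a pointed map. -/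
def homClass {X Y : PtdSpace.{u}} (f : Map X Y) : X ⟶ Y := Quotient.mk (mapSetoid X Y) f

end PtdSpace

/-! ## Polyhedra -/

/-- The geometric realization of an abstract simplicial complex `K`: points are given by their
barycentric coordinates, which are supported in a simplex of `K`. -/
def Polyhedron {V : Type u} (K : AbstractSimplicialComplex V) : Type u :=
  {a : V → ℝ // ∃ s ∈ K.faces, (∀ v ∉ s, a v = 0) ∧ (∀ v, 0 ≤ a v) ∧ ∑ v ∈ s, a v = 1}

namespace Polyhedron

variable {V : Type u} (K : AbstractSimplicialComplex V)

open Classical in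
/-- The inclusion of the closed simplex spanned by `s` in the realization. -/
noncomputable def simplexMap (s : K.faces) (b : stdSimplex ℝ s.1) : Polyhedron K :=
  ⟨fun v => if h : v ∈ s.1 then b.1 ⟨v, h⟩ else 0, s.1, s.2,
    fun v hv => by simp [hv],
    fun v => by
      by_cases hv : v ∈ s.1
      · simpa [hv] using b.2.1 ⟨v, hv⟩
      · simp [hv],
    by
      rw [← Finset.sum_coe_sort]
      simpa using b.2.2⟩

/-- The weak topology: a set is open iff its trace on every closed simplex is open. -/
noncomputable instance : TopologicalSpace (Polyhedron K) :=
  ⨆ s : K.faces, TopologicalSpace.coinduced (simplexMap K s) inferInstance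

end Polyhedron

/-- The objects of `HPol_*`, a full subcategory of `HTop_*`: pointed spaces of the pointed homotopy
type of a pointed polyhedron. -/
def IsHPol (X : PtdSpace.{u}) : Prop :=
  ∃ (V : Type u) (K : AbstractSimplicialComplex V) (a : Polyhedron K),
    Nonempty (X ≅ (⟨Polyhedron K, a⟩ : PtdSpace.{u}))

/-! ## Inverse systems and the category pro*-C -/

/-- Inverse systems in `C`, indexed by directed preordered sets. -/
structure InvSystem (C : Type v) [Category.{u} C] : Type (max v (u + 1)) where
  Idx : Type u
  [preorder : Preorder Idx]
  [directed : IsDirectedOrder Idx]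
  [nonempty : Nonempty Idx]
  obj : Idx → C
  /-- The bonding morphisms. -/
  bond : ∀ {a b : Idx}, a ≤ b → (obj b ⟶ obj a)
  bond_refl : ∀ a, bond (le_refl a) = 𝟙 (obj a)
  bond_comp : ∀ {a b c : Idx} (h : a ≤ b) (h' : b ≤ c), bond h' ≫ bond h = bond (h.trans h')

attribute [instance] InvSystem.preorder InvSystem.directed InvSystem.nonempty

namespace InvSystem

variable {C : Type v} [Category.{u} C]

/-- The rudimentary system on an object. -/
def rud (S : C) : InvSystem C where
  Idx := PUnit
  obj _ := S
  bond _ := 𝟙 S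
  bond_refl _ := rfl
  bond_comp _ _ := Category.id_comp _

/-- Morphisms of inverse systems `(f, f_μ)` (representatives of morphisms of pro-`C`). -/
structure ProMor (X Y : InvSystem C) where
  idx : Y.Idx → X.Idx
  hom : ∀ μ, X.obj (idx μ) ⟶ Y.obj μ
  comm : ∀ {μ μ' : Y.Idx} (h : μ ≤ μ'), ∃ (l : X.Idx) (h₁ : idx μ ≤ l) (h₂ : idx μ' ≤ l),
    X.bond h₂ ≫ hom μ' ≫ Y.bond h = X.bond h₁ ≫ hom μ

/-- S*-morphisms `(f, f^n_μ)` of inverse systems. -/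
structure SMor (X Y : InvSystem C) where
  idx : Y.Idx → X.Idx
  hom : ∀ (_ : ℕ) (μ : Y.Idx), X.obj (idx μ) ⟶ Y.obj μ
  comm : ∀ {μ μ' : Y.Idx} (h : μ ≤ μ'), ∃ (l : X.Idx) (h₁ : idx μ ≤ l) (h₂ : idx μ' ≤ l) (n : ℕ),
    ∀ m, n ≤ m → X.bond h₂ ≫ hom m μ' ≫ Y.bond h = X.bond h₁ ≫ hom m μ

theorem bond_push {X : InvSystem C} {a b l : X.Idx} {Z : C} {f : X.obj a ⟶ Z} {g : X.obj b ⟶ Z}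
    {ha : a ≤ l} {hb : b ≤ l} (e : X.bond ha ≫ f = X.bond hb ≫ g) {k : X.Idx} (hk : l ≤ k) :
    X.bond (ha.trans hk) ≫ f = X.bond (hb.trans hk) ≫ g := by
  rw [← X.bond_comp ha hk, ← X.bond_comp hb hk, Category.assoc, Category.assoc, e]

/-- Equivalence of S*-morphisms. -/
instance sSetoid (X Y : InvSystem C) : Setoid (SMor X Y) where
  r f g := ∀ μ, ∃ (l : X.Idx) (h₁ : f.idx μ ≤ l) (h₂ : g.idx μ ≤ l) (n : ℕ),
    ∀ m, n ≤ m → X.bond h₁ ≫ f.hom m μ = X.bond h₂ ≫ g.hom m μ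
  iseqv := by
    refine ⟨fun f μ => ⟨_, le_refl _, le_refl _, 0, fun _ _ => rfl⟩, fun h μ => ?_,
      fun h h' μ => ?_⟩
    · obtain ⟨l, h₁, h₂, n, e⟩ := h μ
      exact ⟨l, h₂, h₁, n, fun m hm => (e m hm).symm⟩
    · obtain ⟨l, h₁, h₂, n, e⟩ := h μ
      obtain ⟨l', h₁', h₂', n', e'⟩ := h' μ
      obtain ⟨k, hk, hk'⟩ := exists_ge_ge l l'
      exact ⟨k, h₁.trans hk, h₂'.trans hk', max n n', fun m hm =>
        (bond_push (e m (le_of_max_le_left hm)) hk).trans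
          (bond_push (e' m (le_of_max_le_right hm)) hk')⟩

/-- Composition of S*-morphisms, `(g, g^n_ν)(f, f^n_μ) = (fg, g^n_ν f^n_{g(ν)})`. -/
def SMor.comp {X Y Z : InvSystem C} (f : SMor X Y) (g : SMor Y Z) : SMor X Z where
  idx ν := f.idx (g.idx ν)
  hom n ν := f.hom n (g.idx ν) ≫ g.hom n ν
  comm {ν ν'} h := by
    obtain ⟨μ, h₁, h₂, n, e⟩ := g.comm h
    obtain ⟨l, a₁, a₂, n₁, e₁⟩ := f.comm h₁
    obtain ⟨l', b₁, b₂, n₂, e₂⟩ := f.comm h₂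
    obtain ⟨k, hk, hk'⟩ := exists_ge_ge l l'
    refine ⟨k, a₁.trans hk, b₁.trans hk', max n (max n₁ n₂), fun m hm => ?_⟩
    have hn : n ≤ m := le_of_max_le_left hm
    have hn₁ : n₁ ≤ m := le_of_max_le_left (le_of_max_le_right hm)
    have hn₂ : n₂ ≤ m := le_of_max_le_right (le_of_max_le_right hm)
    have E₁ := bond_push (e₁ m hn₁) hk
    have E₂ := bond_push (e₂ m hn₂) hk'
    calc X.bond (b₁.trans hk') ≫ (f.hom m (g.idx ν') ≫ g.hom m ν') ≫ Z.bond h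
        = (X.bond (b₁.trans hk') ≫ f.hom m (g.idx ν')) ≫ g.hom m ν' ≫ Z.bond h := by
          simp only [Category.assoc]
      _ = (X.bond (b₂.trans hk') ≫ f.hom m μ) ≫ Y.bond h₂ ≫ g.hom m ν' ≫ Z.bond h := by
          rw [← E₂]; simp only [Category.assoc]
      _ = (X.bond (b₂.trans hk') ≫ f.hom m μ) ≫ Y.bond h₁ ≫ g.hom m ν := by rw [e m hn]
      _ = (X.bond (a₂.trans hk) ≫ f.hom m μ) ≫ Y.bond h₁ ≫ g.hom m ν := rfl
      _ = X.bond (a₁.trans hk) ≫ f.hom m (g.idx ν) ≫ g.hom m ν := by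
          simp only [Category.assoc] at E₁ ⊢
          rw [reassoc_of% E₁]

theorem SMor.comp_congr {X Y Z : InvSystem C} {f f' : SMor X Y} {g g' : SMor Y Z}
    (hf : f ≈ f') (hg : g ≈ g') : f.comp g ≈ f'.comp g' := by
  intro ν
  obtain ⟨μ, h₁, h₂, n, e⟩ := hg ν
  obtain ⟨l₁, a₁, a₂, n₁, e₁⟩ := f.comm h₁
  obtain ⟨l₂, b₁, b₂, n₂, e₂⟩ := f'.comm h₂
  obtain ⟨l₃, c₁, c₂, n₃, e₃⟩ := hf μ
  obtain ⟨k₀, hk₁, hk₂⟩ := exists_ge_ge l₁ l₂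
  obtain ⟨k, hk₀, hk₃⟩ := exists_ge_ge k₀ l₃
  refine ⟨k, a₁.trans (hk₁.trans hk₀), b₁.trans (hk₂.trans hk₀), max (max n n₃) (max n₁ n₂),
    fun m hm => ?_⟩
  have hn : n ≤ m := le_of_max_le_left (le_of_max_le_left hm)
  have hn₃ : n₃ ≤ m := le_of_max_le_right (le_of_max_le_left hm)
  have hn₁ : n₁ ≤ m := le_of_max_le_left (le_of_max_le_right hm)
  have hn₂ : n₂ ≤ m := le_of_max_le_right (le_of_max_le_right hm)
  have E₁ := bond_push (e₁ m hn₁) (hk₁.trans hk₀)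
  have E₂ := bond_push (e₂ m hn₂) (hk₂.trans hk₀)
  have E₃ := bond_push (e₃ m hn₃) hk₃
  change X.bond _ ≫ f.hom m (g.idx ν) ≫ g.hom m ν = X.bond _ ≫ f'.hom m (g'.idx ν) ≫ g'.hom m ν
  rw [← reassoc_of% E₁, e m hn, ← reassoc_of% E₂, reassoc_of% E₃]

/-- The category pro*-`C`. -/
instance : Category (InvSystem C) where
  Hom X Y := Quotient (sSetoid X Y)
  id X := ⟦⟨id, fun _ μ => 𝟙 (X.obj μ), fun {μ μ'} h => ⟨μ', h, le_refl _, 0, fun m _ => by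
    simp [X.bond_refl]⟩⟩⟧
  comp f g := Quotient.map₂ SMor.comp (fun _ _ h _ _ h' => SMor.comp_congr h h') f g
  id_comp := by
    rintro X Y ⟨f⟩
    exact Quotient.sound fun μ =>
      ⟨f.idx μ, le_refl _, le_refl _, 0, fun m _ => by simp [SMor.comp]⟩
  comp_id := by
    rintro X Y ⟨f⟩
    exact Quotient.sound fun μ =>
      ⟨f.idx μ, le_refl _, le_refl _, 0, fun m _ => by simp [SMor.comp]⟩
  assoc := by
    rintro W X Y Z ⟨f⟩ ⟨g⟩ ⟨h⟩
    exact Quotient.sound fun μ =>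
      ⟨_, le_refl _, le_refl _, 0, fun m _ => by simp [SMor.comp]⟩

/-- The class of an S*-morphism. -/
def SMor.cls {X Y : InvSystem C} (f : SMor X Y) : X ⟶ Y := Quotient.mk (sSetoid X Y) f

/-- The inclusion of pro-`C` in pro*-`C`: `(f, f_μ)` goes to the class of `(f, f^n_μ = f_μ)`. -/
def ProMor.J {X Y : InvSystem C} (f : ProMor X Y) : X ⟶ Y :=
  SMor.cls ⟨f.idx, fun _ μ => f.hom μ, fun h => by
    obtain ⟨l, h₁, h₂, e⟩ := f.comm h
    exact ⟨l, h₁, h₂, 0, fun _ _ => e⟩⟩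

/-- Composition of morphisms of inverse systems with index functions. -/
def ProMor.comp {X Y Z : InvSystem C} (f : ProMor X Y) (g : ProMor Y Z) : ProMor X Z where
  idx ν := f.idx (g.idx ν)
  hom ν := f.hom (g.idx ν) ≫ g.hom ν
  comm {ν ν'} h := by
    obtain ⟨μ, h₁, h₂, e⟩ := g.comm h
    obtain ⟨l, a₁, a₂, e₁⟩ := f.comm h₁
    obtain ⟨l', b₁, b₂, e₂⟩ := f.comm h₂
    obtain ⟨k, hk, hk'⟩ := exists_ge_ge l l'
    refine ⟨k, a₁.trans hk, b₁.trans hk', ?_⟩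
    have E₁ := bond_push e₁ hk
    have E₂ := bond_push e₂ hk'
    simp only [Category.assoc] at E₁ E₂ ⊢
    rw [← reassoc_of% E₂, e, reassoc_of% E₁]

theorem ProMor.J_comp {X Y Z : InvSystem C} (f : ProMor X Y) (g : ProMor Y Z) :
    (f.comp g).J = f.J ≫ g.J := rfl

end InvSystem

open InvSystem

/-! ## HPol-expansions -/

/-- An `HPol_*`-expansion of the pointed space `X`: a morphism from the rudimentary system `X` to
an inverse system in `HPol_*`, i.e. a family `proj` compatible with the bonding morphisms, with
the properties (E1) and (E2). -/
structure HPolExpansion (X : PtdSpace.{u}) : Type (u + 1) where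
  sys : InvSystem PtdSpace.{u}
  isHPol : ∀ l, IsHPol (sys.obj l)
  proj : ∀ l, X ⟶ sys.obj l
  proj_bond : ∀ {l l'} (h : l ≤ l'), proj l' ≫ sys.bond h = proj l
  E1 : ∀ (P : PtdSpace.{u}), IsHPol P → ∀ h : X ⟶ P, ∃ l, ∃ f : sys.obj l ⟶ P, proj l ≫ f = h
  E2 : ∀ (P : PtdSpace.{u}), IsHPol P → ∀ (l : sys.Idx) (f₀ f₁ : sys.obj l ⟶ P),
    proj l ≫ f₀ = proj l ≫ f₁ → ∃ l', ∃ h : l ≤ l', sys.bond h ≫ f₀ = sys.bond h ≫ f₁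

namespace HPolExpansion

/-- An object of `HPol_*` is its own expansion. -/
def ofHPol (P : PtdSpace.{u}) (hP : IsHPol P) : HPolExpansion P where
  sys := rud P
  isHPol _ := hP
  proj _ := 𝟙 P
  proj_bond _ := Category.id_comp _
  E1 _ _ h := ⟨PUnit.unit, h, Category.id_comp h⟩
  E2 _ _ l f₀ f₁ h := ⟨l, le_refl l, by
    have h' : (f₀ : P ⟶ _) = f₁ := by
      rw [← Category.id_comp (X := P) f₀, ← Category.id_comp (X := P) f₁]; exact h
    rw [h']⟩

/-- The morphism `i : 𝐗 → 𝐘` satisfies `i ∘ p = q ∘ h`. -/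
def IsLift {X Y : PtdSpace.{u}} (p : HPolExpansion X) (q : HPolExpansion Y) (h : X ⟶ Y)
    (i : ProMor p.sys q.sys) : Prop :=
  ∀ μ, p.proj (i.idx μ) ≫ i.hom μ = h ≫ q.proj μ

theorem exists_lift {X Y : PtdSpace.{u}} (p : HPolExpansion X) (q : HPolExpansion Y) (h : X ⟶ Y) :
    ∃ i : ProMor p.sys q.sys, IsLift p q h i := by
  choose a f hf using fun μ => p.E1 _ (q.isHPol μ) (h ≫ q.proj μ)
  refine ⟨⟨a, f, fun {μ μ'} hμ => ?_⟩, hf⟩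
  obtain ⟨l, h₁, h₂⟩ := exists_ge_ge (a μ) (a μ')
  obtain ⟨l', hl, e⟩ := p.E2 _ (q.isHPol μ) l (p.sys.bond h₂ ≫ f μ' ≫ q.sys.bond hμ)
    (p.sys.bond h₁ ≫ f μ) (by
      have e₁ := p.proj_bond h₁
      have e₂ := p.proj_bond h₂
      rw [reassoc_of% e₁, reassoc_of% e₂, hf μ, ← Category.assoc, hf μ', Category.assoc,
        q.proj_bond hμ])
  refine ⟨l', h₁.trans hl, h₂.trans hl, ?_⟩
  rw [← p.sys.bond_comp h₁ hl, ← p.sys.bond_comp h₂ hl]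
  simpa using e

theorem lift_unique {X Y : PtdSpace.{u}} {p : HPolExpansion X} {q : HPolExpansion Y} {h : X ⟶ Y}
    {i i' : ProMor p.sys q.sys} (hi : IsLift p q h i) (hi' : IsLift p q h i') : i.J = i'.J := by
  refine Quotient.sound fun μ => ?_
  obtain ⟨l, h₁, h₂⟩ := exists_ge_ge (i.idx μ) (i'.idx μ)
  obtain ⟨l', hl, e⟩ := p.E2 _ (q.isHPol μ) l (p.sys.bond h₁ ≫ i.hom μ)
    (p.sys.bond h₂ ≫ i'.hom μ) (by
      have e₁ := p.proj_bond h₁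
      have e₂ := p.proj_bond h₂
      rw [reassoc_of% e₁, reassoc_of% e₂, hi μ, hi' μ])
  refine ⟨l', h₁.trans hl, h₂.trans hl, 0, fun _ _ => ?_⟩
  rw [← p.sys.bond_comp h₁ hl, ← p.sys.bond_comp h₂ hl]
  simpa using e

theorem IsLift.comp {X Y Z : PtdSpace.{u}} {p : HPolExpansion X} {q : HPolExpansion Y}
    {r : HPolExpansion Z} {h : X ⟶ Y} {h' : Y ⟶ Z} {i : ProMor p.sys q.sys}
    {j : ProMor q.sys r.sys} (hi : IsLift p q h i) (hj : IsLift q r h' j) :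
    IsLift p r (h ≫ h') (i.comp j) := fun μ => by
  change p.proj _ ≫ i.hom _ ≫ j.hom μ = _
  have e := hi (j.idx μ)
  rw [reassoc_of% e, hj μ, Category.assoc]

end HPolExpansion

/-! ## The pointed sphere and sums of pointed maps on it -/

/-- The equivalence relation on the cube `I^k` which collapses its boundary to a point. -/
def cubeSetoid (k : ℕ) : Setoid (I^ (Fin k)) where
  r a b := a = b ∨ (a ∈ Cube.boundary (Fin k) ∧ b ∈ Cube.boundary (Fin k))
  iseqv := ⟨fun _ => Or.inl rfl, by grind, by grind⟩

/-- The pointed `k`-sphere `(S^k, *)`, `k ≥ 1`, in the model `I^k / ∂I^k`, the base point being the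
class of the boundary (a copy of it in the universe `u`). -/
def sphere (k : ℕ) : PtdSpace.{u} where
  carrier := ULift.{u} (Quotient (cubeSetoid k))
  pt := ⟨Quotient.mk (cubeSetoid k) 0⟩

namespace sphere

variable {k : ℕ}

/-- The quotient map `I^k → S^k`. -/
def proj (k : ℕ) : C(I^ (Fin k), sphere.{u} k) where
  toFun a := ⟨Quotient.mk (cubeSetoid k) a⟩
  continuous_toFun := continuous_uliftUp.comp continuous_quotient_mk'

theorem proj_boundary [NeZero k] {a : I^ (Fin k)} (ha : a ∈ Cube.boundary (Fin k)) :
    proj.{u} k a = (sphere.{u} k).pt :=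
  congrArg ULift.up (Quotient.sound (Or.inr ⟨ha, ⟨0, Or.inl rfl⟩⟩))

theorem proj_surjective : Function.Surjective (proj.{u} k) := by
  rintro ⟨⟨a⟩⟩
  exact ⟨a, rfl⟩

/-- A continuous map on the cube which is constant on the boundary descends to the sphere. -/
def desc {Z : Type v} [TopologicalSpace Z] (f : C(I^ (Fin k), Z))
    (hf : ∀ a ∈ Cube.boundary (Fin k), ∀ b ∈ Cube.boundary (Fin k), f a = f b) :
    C(sphere.{u} k, Z) where
  toFun s := Quotient.lift f (by
    rintro a b (h | ⟨ha, hb⟩)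
    · rw [h]
    · exact hf a ha b hb) s.down
  continuous_toFun := by
    refine Continuous.comp (g := Quotient.lift f _) ?_ continuous_uliftDown
    exact Continuous.quotient_lift f.continuous _

variable [NeZero k]

/-- Pointed maps `(S^k, *) → (X, x)` are the same as maps of cubes `(I^k, ∂I^k) → (X, x)`. -/
def mapEquivGenLoop (X : PtdSpace.{u}) : PtdSpace.Map (sphere.{u} k) X ≃ Ω^ (Fin k) X X.pt where
  toFun f := ⟨f.1.comp (proj k), fun a ha => by
    rw [ContinuousMap.comp_apply, proj_boundary ha, f.2]⟩
  invFun g := ⟨desc g.1 (fun a ha b hb => (g.2 a ha).trans (g.2 b hb).symm),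
    g.2 0 ⟨0, Or.inl rfl⟩⟩
  left_inv f := by
    refine Subtype.ext (ContinuousMap.ext fun s => ?_)
    obtain ⟨a, rfl⟩ := proj_surjective s
    rfl
  right_inv g := rfl

theorem homotopic_iff {X : PtdSpace.{u}} (f g : PtdSpace.Map (sphere.{u} k) X) :
    f ≈ g ↔ GenLoop.Homotopic (mapEquivGenLoop X f) (mapEquivGenLoop X g) := by
  constructor
  · rintro ⟨H⟩
    refine ⟨⟨⟨⟨fun z => H (z.1, proj k z.2), by fun_prop⟩, ?_, ?_⟩, ?_⟩⟩
    · intro a; exact H.apply_zero _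
    · intro a; exact H.apply_one _
    · intro t a ha
      exact H.eq_fst t (by rw [proj_boundary ha]; rfl)
  · rintro ⟨H⟩
    let G : C(I^ (Fin k), C(I, X)) :=
      ContinuousMap.curry ⟨fun z : (I^ (Fin k)) × I => H (z.2, z.1), by fun_prop⟩
    have hG : ∀ a ∈ Cube.boundary (Fin k), G a = ContinuousMap.const I X.pt := by
      intro a ha
      ext t
      exact (H.eq_fst t ha).trans ((mapEquivGenLoop X f).2 a ha)
    let D : C(sphere.{u} k, C(I, X)) :=
      desc G fun a ha b hb => (hG a ha).trans (hG b hb).symm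
    refine ⟨⟨⟨⟨fun z => D z.2 z.1, by fun_prop⟩, ?_, ?_⟩, ?_⟩⟩
    · intro s
      obtain ⟨a, rfl⟩ := proj_surjective s
      exact H.apply_zero a
    · intro s
      obtain ⟨a, rfl⟩ := proj_surjective s
      exact H.apply_one a
    · intro t s hs
      obtain rfl := Set.mem_singleton_iff.1 hs
      have h0 : (0 : I^ (Fin k)) ∈ Cube.boundary (Fin k) := ⟨0, Or.inl rfl⟩
      exact H.eq_fst t h0

/-- Pointed homotopy classes of maps `(S^k, *) → (X, x)` and the `k`-th homotopy group. -/
def homEquiv (X : PtdSpace.{u}) : (sphere.{u} k ⟶ X) ≃ HomotopyGroup (Fin k) X X.pt :=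
  Quotient.congr (mapEquivGenLoop X) fun f g => homotopic_iff f g

/-- The group of pointed homotopy classes of maps `(S^k, *) → (X, x)`, where `f * g` is the class
of the concatenation "first `f`, then `g`" of maps of cubes (in Mathlib's homotopy groups the
factors are in the opposite order, which matters for `k = 1` only). -/
noncomputable instance homGroup (X : PtdSpace.{u}) : Group (sphere.{u} k ⟶ X) :=
  ((homEquiv X).trans MulOpposite.opEquiv).group

theorem mul_spec {X : PtdSpace.{u}} (f g : Ω^ (Fin k) X X.pt) :
    PtdSpace.homClass ((mapEquivGenLoop X).symm f) * PtdSpace.homClass ((mapEquivGenLoop X).symm g)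
      = PtdSpace.homClass ((mapEquivGenLoop X).symm (GenLoop.transAt 0 f g)) := by
  refine ((homEquiv X).trans MulOpposite.opEquiv).injective ?_
  refine (((homEquiv X).trans MulOpposite.opEquiv).apply_symm_apply _).trans ?_
  exact congrArg MulOpposite.op (HomotopyGroup.mul_spec (i := 0) (p := g) (q := f))

theorem mul_comp {X Y : PtdSpace.{u}} (a b : sphere.{u} k ⟶ X) (h : X ⟶ Y) :
    (a * b) ≫ h = (a ≫ h) * (b ≫ h) := by
  induction a using Quotient.inductionOn with | _ a
  induction b using Quotient.inductionOn with | _ b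
  induction h using Quotient.inductionOn with | _ h
  obtain ⟨f, rfl⟩ := (mapEquivGenLoop X).symm.surjective a
  obtain ⟨g, rfl⟩ := (mapEquivGenLoop X).symm.surjective b
  let push : (Ω^ (Fin k) X X.pt) → Ω^ (Fin k) Y Y.pt := fun f =>
    ⟨h.1.comp f.1, fun a ha => (congrArg h.1 (f.2 a ha)).trans h.2⟩
  have hpush : ∀ f, ((mapEquivGenLoop X).symm f).comp h = (mapEquivGenLoop Y).symm (push f) := by
    intro f
    refine Subtype.ext (ContinuousMap.ext fun s => ?_)
    obtain ⟨a, rfl⟩ := proj_surjective s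
    rfl
  have hcomp : ∀ f, PtdSpace.homClass ((mapEquivGenLoop X).symm f) ≫ PtdSpace.homClass h
      = PtdSpace.homClass ((mapEquivGenLoop Y).symm (push f)) := fun f =>
    congrArg PtdSpace.homClass (hpush f)
  change (PtdSpace.homClass _ * PtdSpace.homClass _) ≫ PtdSpace.homClass h
    = (PtdSpace.homClass _ ≫ PtdSpace.homClass h) * (PtdSpace.homClass _ ≫ PtdSpace.homClass h)
  rw [mul_spec, hcomp, hcomp, hcomp, mul_spec]
  congr 2
  ext t
  change h.1 (if (t 0 : ℝ) ≤ 1 / 2 then f _ else g _)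
    = if (t 0 : ℝ) ≤ 1 / 2 then h.1 (f _) else h.1 (g _)
  split_ifs <;> rfl

theorem one_comp {X Y : PtdSpace.{u}} (h : X ⟶ Y) :
    (1 : sphere.{u} k ⟶ X) ≫ h = 1 := by
  have := mul_comp (1 : sphere.{u} k ⟶ X) 1 h
  rw [one_mul] at this
  exact (left_eq_mul.1 this)

theorem inv_comp {X Y : PtdSpace.{u}} (a : sphere.{u} k ⟶ X) (h : X ⟶ Y) :
    a⁻¹ ≫ h = (a ≫ h)⁻¹ := by
  refine eq_inv_of_mul_eq_one_left ?_
  rw [← mul_comp, inv_mul_cancel, one_comp]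

end sphere

/-! ## The group of morphisms `(S^k, *) → 𝐗` of pro*-HTop -/

namespace SphereMor

variable {k : ℕ} {X : InvSystem PtdSpace.{u}}

/-- The components `f^n_μ : S^k → X_μ` of an S*-morphism on the rudimentary system `(S^k, *)`. -/
def comps (f : SMor (rud (sphere.{u} k)) X) (n : ℕ) (μ : X.Idx) : sphere.{u} k ⟶ X.obj μ :=
  f.hom n μ

theorem comps_comm (f : SMor (rud (sphere.{u} k)) X) {μ μ' : X.Idx} (h : μ ≤ μ') :
    ∃ n : ℕ, ∀ m, n ≤ m → comps f m μ' ≫ X.bond h = comps f m μ := by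
  obtain ⟨_, _, _, n, e⟩ := f.comm h
  refine ⟨n, fun m hm => ?_⟩
  have := e m hm
  change 𝟙 (sphere.{u} k) ≫ comps f m μ' ≫ X.bond h = 𝟙 (sphere.{u} k) ≫ comps f m μ at this
  simpa only [Category.id_comp] using this

/-- The S*-morphism with given components. -/
def ofComps (a : ∀ (_ : ℕ) (μ : X.Idx), sphere.{u} k ⟶ X.obj μ)
    (ha : ∀ {μ μ' : X.Idx} (h : μ ≤ μ'), ∃ n : ℕ, ∀ m, n ≤ m → a m μ' ≫ X.bond h = a m μ) :
    SMor (rud (sphere.{u} k)) X where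
  idx _ := PUnit.unit
  hom := a
  comm {μ μ'} h := by
    obtain ⟨n, e⟩ := ha h
    refine ⟨PUnit.unit, le_refl _, le_refl _, n, fun m hm => ?_⟩
    change 𝟙 (sphere.{u} k) ≫ a m μ' ≫ X.bond h = 𝟙 (sphere.{u} k) ≫ a m μ
    rw [e m hm]

theorem equiv_iff (f g : SMor (rud (sphere.{u} k)) X) :
    f ≈ g ↔ ∀ μ, ∃ n : ℕ, ∀ m, n ≤ m → comps f m μ = comps g m μ := by
  constructor
  · intro h μ
    obtain ⟨_, _, _, n, e⟩ := h μ
    refine ⟨n, fun m hm => ?_⟩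
    have := e m hm
    change 𝟙 (sphere.{u} k) ≫ comps f m μ = 𝟙 (sphere.{u} k) ≫ comps g m μ at this
    simpa only [Category.id_comp] using this
  · intro h μ
    obtain ⟨n, e⟩ := h μ
    exact ⟨PUnit.unit, le_refl _, le_refl _, n, fun m hm =>
      congrArg (fun z => 𝟙 (sphere.{u} k) ≫ z) (e m hm)⟩

variable [NeZero k]

noncomputable def mul (f g : SMor (rud (sphere.{u} k)) X) : SMor (rud (sphere.{u} k)) X :=
  ofComps (fun n μ => comps f n μ * comps g n μ) fun h => by
    obtain ⟨n, e⟩ := comps_comm f h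
    obtain ⟨n', e'⟩ := comps_comm g h
    exact ⟨max n n', fun m hm => by
      rw [sphere.mul_comp, e m (le_of_max_le_left hm), e' m (le_of_max_le_right hm)]⟩

noncomputable def one : SMor (rud (sphere.{u} k)) X :=
  ofComps (fun _ _ => 1) fun _ => ⟨0, fun _ _ => sphere.one_comp _⟩

noncomputable def inv (f : SMor (rud (sphere.{u} k)) X) : SMor (rud (sphere.{u} k)) X :=
  ofComps (fun n μ => (comps f n μ)⁻¹) fun h => by
    obtain ⟨n, e⟩ := comps_comm f h
    exact ⟨n, fun m hm => by rw [sphere.inv_comp, e m hm]⟩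

/-- The group of morphisms `(S^k, *) → 𝐗` of pro*-`HTop_*`, with
`[(f^n_μ)] * [(g^n_μ)] = [(f^n_μ * g^n_μ)]`. -/
noncomputable instance group (X : InvSystem PtdSpace.{u}) : Group (rud (sphere.{u} k) ⟶ X) where
  mul := Quotient.map₂ mul fun f f' hf g g' hg => (equiv_iff _ _).2 fun μ => by
    obtain ⟨n, e⟩ := (equiv_iff _ _).1 hf μ
    obtain ⟨n', e'⟩ := (equiv_iff _ _).1 hg μ
    exact ⟨max n n', fun m hm => congrArg₂ (· * ·) (e m (le_of_max_le_left hm))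
      (e' m (le_of_max_le_right hm))⟩
  one := Quotient.mk _ one
  inv := Quotient.map inv fun f f' hf => (equiv_iff _ _).2 fun μ => by
    obtain ⟨n, e⟩ := (equiv_iff _ _).1 hf μ
    exact ⟨n, fun m hm => congrArg (·⁻¹) (e m hm)⟩
  mul_assoc := by
    rintro ⟨f⟩ ⟨g⟩ ⟨h⟩
    exact Quotient.sound ((equiv_iff _ _).2 fun μ => ⟨0, fun m _ => mul_assoc _ _ _⟩)
  one_mul := by
    rintro ⟨f⟩
    exact Quotient.sound ((equiv_iff _ _).2 fun μ => ⟨0, fun m _ => one_mul _⟩)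
  mul_one := by
    rintro ⟨f⟩
    exact Quotient.sound ((equiv_iff _ _).2 fun μ => ⟨0, fun m _ => mul_one _⟩)
  inv_mul_cancel := by
    rintro ⟨f⟩
    exact Quotient.sound ((equiv_iff _ _).2 fun μ => ⟨0, fun m _ => inv_mul_cancel _⟩)

theorem mul_J {X Y : InvSystem PtdSpace.{u}} (a b : rud (sphere.{u} k) ⟶ X) (i : ProMor X Y) :
    (a * b) ≫ i.J = (a ≫ i.J) * (b ≫ i.J) := by
  induction a using Quotient.inductionOn with | _ f
  induction b using Quotient.inductionOn with | _ g
  exact Quotient.sound ((equiv_iff _ _).2 fun μ =>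
    ⟨0, fun m _ => sphere.mul_comp (comps f m _) (comps g m _) (i.hom μ)⟩)

theorem one_J {X Y : InvSystem PtdSpace.{u}} (i : ProMor X Y) :
    (1 : rud (sphere.{u} k) ⟶ X) ≫ i.J = 1 := by
  have := mul_J (1 : rud (sphere.{u} k) ⟶ X) 1 i
  rw [one_mul] at this
  exact (left_eq_mul.1 this)

theorem inv_J {X Y : InvSystem PtdSpace.{u}} (a : rud (sphere.{u} k) ⟶ X) (i : ProMor X Y) :
    a⁻¹ ≫ i.J = (a ≫ i.J)⁻¹ := by
  refine eq_inv_of_mul_eq_one_left ?_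
  rw [← mul_J, inv_mul_cancel, one_J]

end SphereMor

/-! ## The topological coarse shape homotopy groups -/

/-- Coarse shape morphisms `F* : (S^k, *) → (X, x)`. An equivalence class `⟨f*⟩` of morphisms
`f* : (S^k, *) → 𝐗` of pro*-HPol, over all `HPol_*`-expansions `p : X → 𝐗`, has exactly one
representative over each `p`; it is given by the family `rep` of its representatives, which
correspond to each other under the canonical isomorphisms `i : 𝐗 → 𝐗'` with `i ∘ p = p'`.
(The polyhedron `S^k` is represented by its rudimentary system.) -/
@[ext]
structure CoarsePi (k : ℕ) (X : PtdSpace.{u}) : Type (u + 1) where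
  rep : ∀ p : HPolExpansion X, rud (sphere.{u} k) ⟶ p.sys
  compat : ∀ (p p' : HPolExpansion X) (i : ProMor p.sys p'.sys),
    HPolExpansion.IsLift p p' (𝟙 X) i → rep p ≫ i.J = rep p'

namespace CoarsePi

variable {k : ℕ} [NeZero k] {X Y : PtdSpace.{u}}

noncomputable instance : Mul (CoarsePi k X) :=
  ⟨fun F G => ⟨fun p => F.rep p * G.rep p, fun p p' i hi => by
    rw [SphereMor.mul_J, F.compat p p' i hi, G.compat p p' i hi]⟩⟩

noncomputable instance : One (CoarsePi k X) := ⟨⟨fun _ => 1, fun _ _ i _ => SphereMor.one_J i⟩⟩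

noncomputable instance : Inv (CoarsePi k X) :=
  ⟨fun F => ⟨fun p => (F.rep p)⁻¹, fun p p' i hi => by
    rw [SphereMor.inv_J, F.compat p p' i hi]⟩⟩

/-- The `k`-th coarse shape homotopy group, `⟨f*⟩ * ⟨g*⟩ = ⟨f* * g*⟩`. -/
noncomputable instance : Group (CoarsePi k X) :=
  Group.ofLeftAxioms
    (fun F G H => CoarsePi.ext (funext fun p => mul_assoc (F.rep p) (G.rep p) (H.rep p)))
    (fun F => CoarsePi.ext (funext fun p => one_mul (F.rep p)))
    (fun F => CoarsePi.ext (funext fun p => inv_mul_cancel (F.rep p)))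

/-- The homomorphism `F* ↦ h ∘ F*` induced by a morphism `h : X → Y` of `HTop_*`: with expansions
`p` of `X` and `q` of `Y`, it composes the representative over `p` with the (image in pro*-HPol of
the) unique `i : 𝐗 → 𝐘` such that `i ∘ p = q ∘ h`. It is calculated with an expansion `p` of `X`,
on which it does not depend (see `push_eq`). -/
noncomputable def push (p : HPolExpansion X) (h : X ⟶ Y) : CoarsePi k X →* CoarsePi k Y where
  toFun F :=
    ⟨fun q => F.rep p ≫ (Classical.choose (p.exists_lift q h)).J, fun q q' i hi => by
      rw [Category.assoc, ← ProMor.J_comp]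
      congr 1
      refine HPolExpansion.lift_unique (h := h) ?_ (Classical.choose_spec (p.exists_lift q' h))
      simpa using (Classical.choose_spec (p.exists_lift q h)).comp hi⟩
  map_one' := CoarsePi.ext (funext fun _ => SphereMor.one_J _)
  map_mul' F G := CoarsePi.ext (funext fun _ => SphereMor.mul_J (F.rep p) (G.rep p) _)

theorem push_rep (p : HPolExpansion X) (q : HPolExpansion Y) (h : X ⟶ Y) (F : CoarsePi k X)
    {i : ProMor p.sys q.sys} (hi : HPolExpansion.IsLift p q h i) :
    (push p h F).rep q = F.rep p ≫ i.J :=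
  congrArg (fun z => F.rep p ≫ z)
    (HPolExpansion.lift_unique (Classical.choose_spec (p.exists_lift q h)) hi)

theorem push_eq (p p' : HPolExpansion X) (h : X ⟶ Y) (F : CoarsePi k X) :
    push p h F = push p' h F := by
  refine CoarsePi.ext (funext fun q => ?_)
  obtain ⟨j, hj⟩ := p.exists_lift p' (𝟙 X)
  obtain ⟨i, hi⟩ := p'.exists_lift q h
  rw [push_rep p' q h F hi, push_rep p q h F (i := j.comp i) (by simpa using hj.comp hi),
    ProMor.J_comp, ← F.compat p p' j hj, Category.assoc]

/-- The set `V_λ^F = {G | p_λ ∘ F = p_λ ∘ G}`. -/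
def basicSet (p : HPolExpansion X) (l : p.sys.Idx) (F : CoarsePi k X) : Set (CoarsePi k X) :=
  {G | push p (p.proj l) F = push p (p.proj l) G}

/-- The topology generated by the sets `V_λ^F` (the topologies given by the different expansions
`p` coincide). -/
instance : TopologicalSpace (CoarsePi k X) :=
  ⨅ p : HPolExpansion X, TopologicalSpace.generateFrom
    {U | ∃ (l : p.sys.Idx) (F : CoarsePi k X), U = basicSet p l F}

end CoarsePi

/-! ## Inverse limits of groups and prodiscrete groups -/

/-- The inverse limit of groups `H i` with bonding homomorphisms `φ`, as a subgroup of the product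
(a topological subspace of it if the `H i` have topologies). -/
def groupLimit {Λ : Type*} [Preorder Λ] (H : Λ → Type*) [∀ i, Group (H i)]
    (φ : ∀ {i j : Λ}, i ≤ j → H j →* H i) : Subgroup (∀ i, H i) where
  carrier := {a | ∀ (i j : Λ) (h : i ≤ j), φ h (a j) = a i}
  mul_mem' ha hb i j h := by
    rw [Pi.mul_apply, Pi.mul_apply, map_mul, ha i j h, hb i j h]
  one_mem' _ _ _ := map_one _
  inv_mem' ha i j h := by
    rw [Pi.inv_apply, Pi.inv_apply, map_inv, ha i j h]

/-- `G` is isomorphic as a topological group to the inverse limit of a (directed) inverse system of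
discrete groups. -/
def IsProdiscrete (G : Type v) [Group G] [TopologicalSpace G] : Prop :=
  ∃ (Λ : Type v) (_ : Preorder Λ) (_ : IsDirectedOrder Λ) (_ : Nonempty Λ) (H : Λ → Type v)
    (_ : ∀ i, Group (H i)) (_ : ∀ i, TopologicalSpace (H i)) (_ : ∀ i, DiscreteTopology (H i))
    (φ : ∀ {i j : Λ}, i ≤ j → H j →* H i),
    (∀ i, φ (le_refl i) = MonoidHom.id (H i)) ∧
    (∀ {i j l : Λ} (h : i ≤ j) (h' : j ≤ l), (φ h).comp (φ h') = φ (h.trans h')) ∧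
    Nonempty (G ≃ₜ* groupLimit H φ)

/-- The bonding homomorphism of coarse shape homotopy groups induced by the bonding morphism
`p_{λλ'} : X_λ' → X_λ` of an expansion. -/
noncomputable def HPolExpansion.pushBond (k : ℕ) [NeZero k] {X : PtdSpace.{u}}
    (p : HPolExpansion X) {l l' : p.sys.Idx} (h : l ≤ l') :
    CoarsePi k (p.sys.obj l') →* CoarsePi k (p.sys.obj l) :=
  CoarsePi.push (HPolExpansion.ofHPol _ (p.isHPol l')) (p.sys.bond h)

/-! A morphism of pro* from the sphere to a system is a family of sequences `(f^n_λ)`. Its coherence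
along `λ ≤ λ'` and the equality of two families are required only for large `n`, with a bound that
may depend on the indices. Over a single term `X_λ` the same data are an arbitrary sequence up to
finitely many entries. Hence representatives chosen independently for the entries of a thread of the
inverse limit already form a morphism, and two morphisms agree as soon as all their projections do:
this is `toLimit_surjective` and `toLimit_injective`.

For the topology, a space in `HPol_*` is an expansion of itself with the identity as projection, so
its basic sets are points (`discreteTopology_of_isHPol`). A set of the form `{F | p_λ ∘ F ∈ S}` is a
union of basic sets. Conversely, by (E1) every projection `q_l` of another expansion factors through
some `p_m`, so a basic set of `q` is pulled back from the discrete group of `X_m`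
(`isOpen_toLimit_preimage_basicSet`).

The unconditional conclusions also need every pointed space `X` to have an expansion. Polyhedra
under `X` with vertex set `X` form a small category; once it is known to be filtered (with arrows
reversed), a final functor from a directed set gives the expansion. Finite limits do not exist up to
homotopy, but weak substitutes do among open subsets of normed spaces: products, and homotopy
equalizers realized inside `E × C(I, F)`. Two facts pass between these and polyhedra: every pointed
polyhedron is a homotopy retract of an open subset of a normed space (`Polyhedron.isOpenDominated`),
and every map from `X` to such a subset factors up to homotopy through a polyhedron with vertices in
`X` (`exists_factor_of_isOpen`, by a partition of unity). -/

/-! ## Maps into and out of polyhedra -/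

namespace Polyhedron

section

variable {V : Type u} {K : AbstractSimplicialComplex V}

theorem nonneg (p : Polyhedron K) (v : V) : 0 ≤ p.1 v := by
  obtain ⟨s, -, -, h, -⟩ := p.2
  exact h v

theorem sum_eq_one (p : Polyhedron K) {t : Finset V} (ht : ∀ v ∉ t, p.1 v = 0) :
    ∑ v ∈ t, p.1 v = 1 := by
  obtain ⟨s, -, hs, -, h⟩ := p.2
  have e : ∀ r : Finset V, (∀ v ∉ r, p.1 v = 0) → ∑ᶠ v, p.1 v = ∑ v ∈ r, p.1 v := fun r hr =>
    finsum_eq_sum_of_support_subset _ fun v hv => by_contra fun h' => hv (hr v h')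
  exact (e t ht).symm.trans ((e s hs).trans h)

theorem simplexMap_zero (s : K.faces) (b : stdSimplex ℝ s.1) {v : V} (hv : v ∉ s.1) :
    (simplexMap K s b).1 v = 0 := dif_neg hv

theorem simplexMap_coe (s : K.faces) (b : stdSimplex ℝ s.1) (v : s.1) :
    (simplexMap K s b).1 v = b.1 v := dif_pos v.2

theorem continuous_simplexMap (s : K.faces) : Continuous (simplexMap K s) :=
  continuous_iSup_rng (i := s) continuous_coinduced_rng

theorem exists_simplexMap_eq (p : Polyhedron K) (s : K.faces) (hs : ∀ v ∉ s.1, p.1 v = 0) :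
    ∃ b, simplexMap K s b = p := by
  refine ⟨⟨fun v => p.1 v, fun v => p.nonneg v, ?_⟩, Subtype.ext (funext fun v => ?_)⟩
  · rw [Finset.sum_coe_sort s.1 p.1]
    exact p.sum_eq_one hs
  · by_cases hv : v ∈ s.1
    · exact dif_pos hv
    · rw [simplexMap_zero s _ hv, hs v hv]

theorem exists_simplex (p : Polyhedron K) : ∃ s b, simplexMap K s b = p := by
  obtain ⟨s, hs, h, -⟩ := p.2
  exact ⟨⟨s, hs⟩, p.exists_simplexMap_eq ⟨s, hs⟩ h⟩

theorem continuous_of_simplexMap {Z : Type*} [TopologicalSpace Z] {f : Polyhedron K → Z}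
    (hf : ∀ s, Continuous fun b => f (simplexMap K s b)) : Continuous f :=
  continuous_iSup_dom.2 fun s => continuous_coinduced_dom.2 (hf s)

/-- The weak topology is compatible with products with the unit interval. -/
theorem continuous_prod_of_simplexMap {Z : Type*} [TopologicalSpace Z] {F : Polyhedron K × I → Z}
    (hF : ∀ s, Continuous fun z : stdSimplex ℝ s.1 × I => F (simplexMap K s z.1, z.2)) :
    Continuous F := by
  have hc : ∀ p, Continuous fun t => F (p, t) := fun p => by
    obtain ⟨s, b, rfl⟩ := p.exists_simplex
    exact (hF s).comp (Continuous.prodMk_right b)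
  -- After currying, continuity into `C(I, Z)` can be tested on simplices; evaluation is continuous
  -- because `I` is locally compact.
  have hG : Continuous fun p => (⟨fun t => F (p, t), hc p⟩ : C(I, Z)) :=
    continuous_of_simplexMap fun s => (ContinuousMap.curry ⟨_, hF s⟩).continuous
  have : Continuous fun z : Polyhedron K × I => (⟨fun t => F (z.1, t), hc z.1⟩ : C(I, Z)) z.2 :=
    ContinuousEval.continuous_eval.comp ((hG.comp continuous_fst).prodMk continuous_snd)
  exact this

theorem continuous_coord (v : V) : Continuous fun p : Polyhedron K => p.1 v := by
  refine continuous_of_simplexMap fun s => ?_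
  by_cases hv : v ∈ s.1
  · exact ((continuous_apply (⟨v, hv⟩ : s.1)).comp continuous_subtype_val).congr
      fun b => (simplexMap_coe s b ⟨v, hv⟩).symm
  · exact continuous_const.congr fun b => (simplexMap_zero s b hv).symm

/-- A map to a polyhedron with continuous barycentric coordinates is continuous if it sends a
neighbourhood of each point into a simplex. -/
theorem continuous_of_coord {Y : Type*} [TopologicalSpace Y] {f : Y → Polyhedron K}
    (hf : ∀ y, ∃ s ∈ K.faces, ∀ᶠ z in 𝓝 y, ∀ v ∉ s, (f z).1 v = 0)
    (hc : ∀ v, Continuous fun y => (f y).1 v) : Continuous f := by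
  refine continuous_iff_continuousAt.2 fun y => ?_
  obtain ⟨s, hs, h⟩ := hf y
  refine ContinuousOn.continuousAt ?_ h
  rw [continuousOn_iff_continuous_domRestrict]
  let b : {z | ∀ v ∉ s, (f z).1 v = 0} → stdSimplex ℝ s := fun z =>
    ⟨fun v => (f z).1 v, fun v => (f z).nonneg v, by
      rw [Finset.sum_coe_sort s (f z).1]; exact (f z).sum_eq_one z.2⟩
  have hb : Continuous b :=
    continuous_induced_rng.2 (continuous_pi fun v => (hc v).comp continuous_subtype_val)
  refine ((continuous_simplexMap ⟨s, hs⟩).comp hb).congr fun z => Subtype.ext (funext fun v => ?_)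
  by_cases hv : v ∈ s
  · exact dif_pos hv
  · exact (simplexMap_zero ⟨s, hs⟩ _ hv).trans (z.2 v hv).symm

theorem exists_coord_pos {p : Polyhedron K} {s : Finset V} (h : ∀ v ∉ s, p.1 v = 0) :
    ∃ v ∈ s, 0 < p.1 v := by
  by_contra! hc
  have := p.sum_eq_one h
  rw [Finset.sum_eq_zero fun v hv => le_antisymm (hc v hv) (p.nonneg v)] at this
  exact zero_ne_one this

section baryMap

variable {Y : Type*} [TopologicalSpace Y] (g : V → Y → ℝ)

/-- The map to a polyhedron whose barycentric coordinates are proportional to given functions. -/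
noncomputable def baryMap (hc : ∀ v, Continuous (g v)) (h0 : ∀ v y, 0 ≤ g v y)
    (hp : ∀ y, ∃ v, 0 < g v y)
    (hs : ∀ y, ∃ s ∈ K.faces, ∀ᶠ z in 𝓝 y, ∀ v ∉ s, g v z = 0) : C(Y, Polyhedron K) where
  toFun y := ⟨fun v => g v y / ∑ᶠ w, g w y, by
    obtain ⟨s, hs, h⟩ := hs y
    have h := h.self_of_nhds
    have e : ∑ᶠ w, g w y = ∑ w ∈ s, g w y := finsum_eq_sum_of_support_subset _
      fun v hv => by_contra fun h' => hv (h v h')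
    refine ⟨s, hs, fun v hv => by simp [h v hv],
      fun v => div_nonneg (h0 v y) (finsum_nonneg fun w => h0 w y), ?_⟩
    rw [e, ← Finset.sum_div, div_self]
    obtain ⟨v, hv⟩ := hp y
    have hvs : v ∈ s := by_contra fun h' => hv.ne' (h v h')
    exact (Finset.sum_pos' (fun w _ => h0 w y) ⟨v, hvs, hv⟩).ne'⟩
  continuous_toFun := by
    -- Near each point only the vertices of one simplex contribute, so the normalizing sum is
    -- locally finite and therefore continuous.
    have hlf : LocallyFinite fun v => Function.support (g v) := fun y => by
      obtain ⟨s, -, h⟩ := hs y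
      refine ⟨_, h, s.finite_toSet.subset ?_⟩
      rintro v ⟨z, hz, hz'⟩
      exact by_contra fun h' => hz (hz' v h')
    refine continuous_of_coord (fun y => ?_) fun v => (hc v).div (continuous_finsum hc hlf) fun y => ?_
    · obtain ⟨s, hs, h⟩ := hs y
      exact ⟨s, hs, h.mono fun z hz v hv => by simp [hz v hv]⟩
    · obtain ⟨v, hv⟩ := hp y
      refine (lt_of_lt_of_le hv (single_le_finsum v ?_ fun w => h0 w y)).ne'
      exact hlf.point_finite y

end baryMap

/-- Contiguous maps are homotopic (relative to the set where they coincide). -/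
theorem homotopicRel_of_contiguous {V' : Type v} {L : AbstractSimplicialComplex V'}
    {f g : C(Polyhedron K, Polyhedron L)} {A : Set (Polyhedron K)} (hA : ∀ p ∈ A, f p = g p)
    (h : ∀ s ∈ K.faces, ∃ t ∈ L.faces, ∀ p : Polyhedron K, (∀ v ∉ s, p.1 v = 0) →
      ∀ v ∉ t, (f p).1 v = 0 ∧ (g p).1 v = 0) : f.HomotopicRel g A := by
  -- The straight-line homotopy: both ends lie in the common simplex `t`, and it is stationary
  -- wherever `f` and `g` agree.
  let F : Polyhedron K × I → Polyhedron L := fun z =>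
    ⟨fun v => (1 - (z.2 : ℝ)) * (f z.1).1 v + z.2 * (g z.1).1 v, by
      obtain ⟨s, hs, hz, -⟩ := z.1.2
      obtain ⟨t, ht, e⟩ := h s hs
      refine ⟨t, ht, fun v hv => ?_, fun v => ?_, ?_⟩
      · change (1 - (z.2 : ℝ)) * (f z.1).1 v + z.2 * (g z.1).1 v = 0
        rw [(e z.1 hz v hv).1, (e z.1 hz v hv).2]; simp
      · exact add_nonneg (mul_nonneg (sub_nonneg.2 z.2.2.2) ((f z.1).nonneg v))
          (mul_nonneg z.2.2.1 ((g z.1).nonneg v))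
      · rw [Finset.sum_add_distrib, ← Finset.mul_sum, ← Finset.mul_sum,
          sum_eq_one _ fun v hv => (e z.1 hz v hv).1, sum_eq_one _ fun v hv => (e z.1 hz v hv).2]
        ring⟩
  have hF : Continuous F := by
    refine continuous_prod_of_simplexMap fun s => continuous_of_coord (fun y => ?_) fun v => ?_
    · obtain ⟨t, ht, e⟩ := h s.1 s.2
      refine ⟨t, ht, Filter.Eventually.of_forall fun z v hv => ?_⟩
      have := e (simplexMap K s z.1) (fun v => simplexMap_zero s z.1) v hv
      change (1 - (z.2 : ℝ)) * (f (simplexMap K s z.1)).1 v + z.2 * (g (simplexMap K s z.1)).1 v = 0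
      rw [this.1, this.2]; simp
    · have hs := continuous_simplexMap s
      have h₁ := (continuous_coord v).comp (f.continuous.comp (hs.comp (continuous_fst (Y := I))))
      have h₂ := (continuous_coord v).comp (g.continuous.comp (hs.comp (continuous_fst (Y := I))))
      have h₃ : Continuous fun z : stdSimplex ℝ s.1 × I => (z.2 : ℝ) := by fun_prop
      exact ((continuous_const.sub h₃).mul h₁).add (h₃.mul h₂)
  refine ⟨⟨⟨⟨fun z => F (z.2, z.1), hF.comp continuous_swap⟩, fun p => ?_, fun p => ?_⟩,
    fun t p hp => ?_⟩⟩
  · exact Subtype.ext (funext fun v => by simp [F])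
  · exact Subtype.ext (funext fun v => by simp [F])
  · refine Subtype.ext (funext fun v => ?_)
    change (1 - (t : ℝ)) * (f p).1 v + t * (g p).1 v = (f p).1 v
    rw [← hA p hp]; ring

end

end Polyhedron

/-! ## Polyhedra are dominated by open subsets of normed spaces -/

/-- A pointed space which is dominated, in the pointed homotopy category, by an open subset of a
normed space. -/
def IsOpenDominated (P : PtdSpace.{u}) : Prop :=
  ∃ (E : Type u) (_ : NormedAddCommGroup E) (_ : NormedSpace ℝ E) (U : Set E) (_ : IsOpen U) (a : U)
    (i : P ⟶ (⟨U, a⟩ : PtdSpace.{u})) (r : (⟨U, a⟩ : PtdSpace.{u}) ⟶ P), i ≫ r = 𝟙 P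

namespace Polyhedron

open Filter

variable {V : Type u} (K : AbstractSimplicialComplex V) (a : Polyhedron K)

/-- Weights on the vertices for which the nonzero weighted coordinates of `a` are equal to `1`. -/
noncomputable def weight (v : V) : ℝ := open Classical in if a.1 v = 0 then 1 else (a.1 v)⁻¹

variable {K}

theorem weight_pos (v : V) : 0 < weight K a v := by
  unfold weight
  split_ifs with h
  · exact one_pos
  · exact inv_pos.2 (lt_of_le_of_ne (a.nonneg v) (Ne.symm h))

/-- The weighted coordinates, as a bounded family. -/
noncomputable def weighted (p : Polyhedron K) : lp (fun _ : V => ℝ) ⊤ :=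
  ⟨fun v => weight K a v * p.1 v, by
    obtain ⟨s, -, hs, -⟩ := p.2
    refine memℓp_infty ((s.finite_toSet.image fun v => ‖weight K a v * p.1 v‖).bddAbove.insert 0
      |>.mono ?_)
    rintro _ ⟨v, rfl⟩
    by_cases hv : v ∈ s
    · exact Or.inr ⟨v, hv, rfl⟩
    · left; simp [hs v hv]⟩

theorem weighted_apply (p : Polyhedron K) (v : V) : weighted a p v = weight K a v * p.1 v := rfl

/-- The weak topology only asks for continuity on each closed simplex, where the map is a finite
linear combination of fixed vectors `lp.single`. -/
theorem continuous_weighted : Continuous (weighted a) := by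
  classical
  refine continuous_of_simplexMap fun s => ?_
  have : ∀ b, weighted a (simplexMap K s b)
      = ∑ v : s.1, b.1 v • lp.single (E := fun _ : V => ℝ) ⊤ v.1 (weight K a v) := fun b => by
    refine Subtype.ext (funext fun w => ?_)
    rw [lp.coeFn_sum, Finset.sum_apply]
    by_cases hw : w ∈ s.1
    · rw [Finset.sum_eq_single ⟨w, hw⟩]
      · simp [weighted_apply, simplexMap_coe s b ⟨w, hw⟩, mul_comm]
      · intro v _ hv
        have : w ≠ v.1 := fun h => hv (Subtype.ext h.symm)
        simp [Pi.single_eq_of_ne this]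
      · simp
    · rw [Finset.sum_eq_zero]
      · simp [weighted_apply, simplexMap_zero s b hw]
      · intro v _
        have : w ≠ v.1 := fun h => hw (h ▸ v.2)
        simp [Pi.single_eq_of_ne this]
  simp_rw [this]
  exact continuous_finsetSum _ fun v _ =>
    ((continuous_apply v).comp continuous_subtype_val).smul continuous_const

variable (K) in
/-- The bounded families whose large coordinates span a simplex, locally uniformly. -/
def thick : Set (lp (fun _ : V => ℝ) ⊤) :=
  {b | (∃ s ∈ K.faces, ∀ᶠ c in 𝓝 b, ∀ v ∉ s, c v ≤ ‖c‖ / 2) ∧ ∃ v, ‖b‖ / 2 < b v}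

theorem continuous_lp_coord (v : V) : Continuous fun b : lp (fun _ : V => ℝ) ⊤ => b v := by
  refine Metric.continuous_iff.2 fun b ε hε => ⟨ε, hε, fun c hc => ?_⟩
  rw [dist_eq_norm] at hc ⊢
  exact (lp.norm_apply_le_norm ENNReal.top_ne_zero (c - b) v).trans_lt hc

/-- The first condition is open because it is imposed on a whole neighbourhood, the second because
it is a strict inequality between continuous functions. -/
theorem isOpen_thick : IsOpen (thick K) := by
  refine isOpen_iff_eventually.2 ?_
  rintro b ⟨⟨s, hs, h⟩, v, hv⟩
  have hv' : ∀ᶠ c in 𝓝 b, ‖c‖ / 2 < c v :=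
    (continuous_norm.div_const 2).continuousAt.eventually_lt (continuous_lp_coord v).continuousAt hv
  filter_upwards [h.eventually_nhds, hv'] with c hc hc'
  exact ⟨⟨s, hs, hc⟩, v, hc'⟩

theorem weighted_mem (p : Polyhedron K) : weighted a p ∈ thick K := by
  obtain ⟨s, hs, h, -⟩ := p.2
  obtain ⟨v, -, hv⟩ := exists_coord_pos h
  have hpos : 0 < ‖weighted a p‖ := lt_of_lt_of_le (mul_pos (weight_pos a v) hv)
    ((le_abs_self _).trans (lp.norm_apply_le_norm ENNReal.top_ne_zero (weighted a p) v))
  refine ⟨⟨s, hs, ?_⟩, ?_⟩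
  -- With `N` the norm of the weighted point, a radius `N / 4` suffices: off `s` the coordinates of
  -- `c` are below `N / 4`, while `‖c‖ / 2` exceeds `3N / 8`.
  · filter_upwards [Metric.ball_mem_nhds (weighted a p) (by positivity : 0 < ‖weighted a p‖ / 4)]
      with c hc w hw
    rw [Metric.mem_ball, dist_eq_norm] at hc
    have h₁ := (le_abs_self _).trans
      (lp.norm_apply_le_norm ENNReal.top_ne_zero (c - weighted a p) w)
    have h₂ : (c - weighted a p) w = c w := by
      rw [lp.coeFn_sub, Pi.sub_apply, weighted_apply, h w hw]; simp
    have h₃ := norm_sub_norm_le (weighted a p) c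
    rw [norm_sub_rev] at h₃
    rw [h₂] at h₁
    linarith
  · by_contra! hc
    have := lp.norm_le_of_forall_le (f := weighted a p) (C := ‖weighted a p‖ / 2) (by positivity)
      fun w => by
        rw [weighted_apply, Real.norm_of_nonneg (mul_nonneg (weight_pos a w).le (p.nonneg w))]
        exact hc w
    linarith

/-- The coordinates, up to a factor, of the retraction of `thick K` to the polyhedron. -/
noncomputable def cut (v : V) (b : lp (fun _ : V => ℝ) ⊤) : ℝ :=
  (weight K a v)⁻¹ * max 0 (b v - ‖b‖ / 2)

theorem cut_nonneg (v : V) (b : lp (fun _ : V => ℝ) ⊤) : 0 ≤ cut a v b :=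
  mul_nonneg (inv_nonneg.2 (weight_pos a v).le) (le_max_left _ _)

theorem cut_eq_zero {v : V} {b : lp (fun _ : V => ℝ) ⊤} (h : b v ≤ ‖b‖ / 2) : cut a v b = 0 := by
  rw [cut, max_eq_left (sub_nonpos.2 h), mul_zero]

theorem cut_weighted_eq_zero {v : V} {p : Polyhedron K} (h : p.1 v = 0) :
    cut a v (weighted a p) = 0 :=
  cut_eq_zero a (by rw [weighted_apply, h, mul_zero]; positivity)

/-- The retraction, up to homotopy, of `thick K` to the polyhedron. -/
noncomputable def retract : C(thick K, Polyhedron K) :=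
  baryMap (fun v b => cut a v b.1)
    (fun v => by
      have h₁ : Continuous fun b : thick K => b.1 v :=
        (continuous_lp_coord v).comp continuous_subtype_val
      have h₂ : Continuous fun b : thick K => ‖b.1‖ / 2 :=
        (continuous_norm.comp continuous_subtype_val).div_const 2
      exact continuous_const.mul (continuous_const.max (h₁.sub h₂)))
    (fun v b => cut_nonneg a v b.1)
    (fun b => by
      obtain ⟨v, hv⟩ := b.2.2
      exact ⟨v, mul_pos (inv_pos.2 (weight_pos a v)) (lt_max_of_lt_right (sub_pos.2 hv))⟩)
    (fun b => by
      obtain ⟨s, hs, h⟩ := b.2.1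
      refine ⟨s, hs, ?_⟩
      filter_upwards [continuous_subtype_val.continuousAt.eventually h] with c hc v hv
      exact cut_eq_zero a (hc v hv))

theorem norm_weighted_self : ‖weighted a a‖ = 1 := by
  have h : ∀ v, a.1 v ≠ 0 → weighted a a v = 1 := fun v hv => by
    rw [weighted_apply, weight, if_neg hv, inv_mul_cancel₀ hv]
  refine le_antisymm (lp.norm_le_of_forall_le zero_le_one fun v => ?_) ?_
  · by_cases hv : a.1 v = 0
    · rw [weighted_apply, hv]; simp
    · rw [h v hv]; simp
  · obtain ⟨s, -, hs, -⟩ := a.2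
    obtain ⟨v, -, hv⟩ := exists_coord_pos hs
    have := lp.norm_apply_le_norm ENNReal.top_ne_zero (weighted a a) v
    rwa [h v hv.ne', norm_one] at this

/-- This is what the weights are for: the nonzero weighted coordinates of `a` all equal the norm
`1`, so cutting at `1/2` halves each of them and normalization restores `a`. The retraction is thus
a pointed map. -/
theorem retract_weighted_self : retract a ⟨weighted a a, weighted_mem a a⟩ = a := by
  have h : ∀ v, cut a v (weighted a a) = a.1 v / 2 := fun v => by
    by_cases hv : a.1 v = 0
    · rw [cut_weighted_eq_zero a hv, hv, zero_div]
    · rw [cut, weighted_apply, norm_weighted_self, weight, if_neg hv, inv_mul_cancel₀ hv, inv_inv]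
      norm_num
      ring
  obtain ⟨s, -, hs, -⟩ := a.2
  have hsum : ∑ᶠ v, cut a v (weighted a a) = 1 / 2 := by
    simp_rw [h]
    rw [finsum_eq_sum_of_support_subset (s := s), ← Finset.sum_div, sum_eq_one a hs]
    intro v hv
    exact by_contra fun h' => hv (by simp [hs v h'])
  refine Subtype.ext (funext fun v => ?_)
  change cut a v (weighted a a) / ∑ᶠ w, cut a w (weighted a a) = a.1 v
  rw [hsum, h]
  ring

/-- Embedding and then retracting creates no new nonzero coordinate, so the composite is contiguous
to the identity; it fixes `a`, so the homotopy is pointed. -/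
theorem isOpenDominated : IsOpenDominated (⟨Polyhedron K, a⟩ : PtdSpace.{u}) := by
  let i : C(Polyhedron K, thick K) :=
    ⟨fun p => ⟨weighted a p, weighted_mem a p⟩, (continuous_weighted a).subtype_mk _⟩
  refine ⟨lp (fun _ : V => ℝ) ⊤, inferInstance, inferInstance, thick K, isOpen_thick, i a,
    PtdSpace.homClass ⟨i, rfl⟩, PtdSpace.homClass ⟨retract a, retract_weighted_self a⟩,
    Quotient.sound (ContinuousMap.HomotopicRel.symm (homotopicRel_of_contiguous ?_ ?_))⟩
  · intro p hp
    rw [Set.mem_singleton_iff.1 hp]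
    exact (retract_weighted_self a).symm
  · refine fun s hs => ⟨s, hs, fun p hp v hv => ⟨hp v hv, ?_⟩⟩
    change cut a v (weighted a p) / _ = 0
    rw [cut_weighted_eq_zero a (hp v hv), zero_div]

end Polyhedron

theorem IsHPol.isOpenDominated {P : PtdSpace.{u}} (hP : IsHPol P) : IsOpenDominated P := by
  obtain ⟨V, K, a, ⟨j⟩⟩ := hP
  obtain ⟨E, _, _, U, hU, b, i, r, h⟩ := Polyhedron.isOpenDominated a
  exact ⟨E, inferInstance, inferInstance, U, hU, b, j.hom ≫ i, r ≫ j.inv, by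
    rw [Category.assoc, reassoc_of% h, j.hom_inv_id]⟩

/-! ## Existence of expansions -/

namespace PtdSpace

/-- Pointed maps to a subset of a normed space which are joined by segments in the subset are
homotopic. -/
theorem homClass_eq_of_segment {E : Type u} [NormedAddCommGroup E] [NormedSpace ℝ E] {U : Set E}
    {a : U} {Y : PtdSpace.{u}} {f g : Map Y ⟨U, a⟩}
    (h : ∀ y, segment ℝ (f.1 y).1 (g.1 y).1 ⊆ U) : homClass f = homClass g := by
  have hf : Continuous fun y => (f.1 y).1 := continuous_subtype_val.comp f.1.continuous
  have hg : Continuous fun y => (g.1 y).1 := continuous_subtype_val.comp g.1.continuous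
  refine Quotient.sound ⟨⟨⟨⟨fun z => ⟨AffineMap.lineMap (f.1 z.2).1 (g.1 z.2).1 (z.1 : ℝ),
    h z.2 ?_⟩, ?_⟩, fun y => ?_, fun y => ?_⟩, fun t y hy => ?_⟩⟩
  · rw [segment_eq_image_lineMap]
    exact ⟨z.1, z.1.2, rfl⟩
  · refine continuous_induced_rng.2 ?_
    simp only [Function.comp_def, AffineMap.lineMap_apply_module]
    fun_prop
  · exact Subtype.ext (by simp)
  · exact Subtype.ext (by simp)
  · have e : f.1 y = g.1 y := by rw [Set.mem_singleton_iff.1 hy, f.2, g.2]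
    refine Subtype.ext ?_
    change AffineMap.lineMap (f.1 y).1 (g.1 y).1 (t : ℝ) = (f.1 y).1
    rw [e]; simp

end PtdSpace

/-- The complex of the finite sets of points of a family whose convex hull lies in `U`. -/
def hullComplex {E : Type v} [AddCommGroup E] [Module ℝ E] {V : Type u} (c : V → E) (U : Set E)
    (hc : ∀ v, c v ∈ U) : AbstractSimplicialComplex V where
  faces := {s | s.Nonempty ∧ convexHull ℝ (c '' s) ⊆ U}
  isRelLowerSet_faces := fun _ hs => ⟨hs.1, fun _ ht hn =>
    ⟨hn, (convexHull_mono (Set.image_mono (Finset.coe_subset.2 ht))).trans hs.2⟩⟩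
  singleton_mem v := ⟨Finset.singleton_nonempty v, by simpa using hc v⟩

namespace hullComplex

variable {E : Type v} [NormedAddCommGroup E] [NormedSpace ℝ E] {V : Type u} {c : V → E} {U : Set E}
  {hc : ∀ v, c v ∈ U}

theorem sum_eq (p : Polyhedron (hullComplex c U hc)) {s : Finset V} (hs : ∀ v ∉ s, p.1 v = 0) :
    ∑ᶠ v, p.1 v • c v = ∑ v ∈ s, p.1 v • c v :=
  finsum_eq_sum_of_support_subset _ fun v hv => by_contra fun h' => hv (by simp [hs v h'])

theorem sum_mem_convexHull (p : Polyhedron (hullComplex c U hc)) {s : Finset V}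
    (hs : ∀ v ∉ s, p.1 v = 0) : ∑ᶠ v, p.1 v • c v ∈ convexHull ℝ (c '' s) := by
  rw [sum_eq p hs]
  exact (convex_convexHull ℝ _).sum_mem (fun v _ => p.nonneg v) (p.sum_eq_one hs)
    fun v hv => subset_convexHull ℝ _ (Set.mem_image_of_mem c hv)

variable (c U hc) in
/-- The map from the realization to `U` which is affine on simplices. -/
noncomputable def eval : C(Polyhedron (hullComplex c U hc), U) where
  toFun p := ⟨∑ᶠ v, p.1 v • c v, by
    obtain ⟨s, h, hs, -⟩ := p.2
    exact h.2 (sum_mem_convexHull p hs)⟩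
  continuous_toFun := by
    refine continuous_induced_rng.2 (Polyhedron.continuous_of_simplexMap fun s => ?_)
    have : ∀ b, ∑ᶠ v, (Polyhedron.simplexMap _ s b).1 v • c v = ∑ v : s.1, b.1 v • c v := fun b => by
      rw [sum_eq _ fun v => Polyhedron.simplexMap_zero s b, ← Finset.sum_coe_sort]
      exact Finset.sum_congr rfl fun v _ => by rw [Polyhedron.simplexMap_coe]
    refine Continuous.congr ?_ fun b => (this b).symm
    exact continuous_finsetSum _ fun v _ =>
      ((continuous_apply v).comp continuous_subtype_val).smul continuous_const

end hullComplex

open PtdSpace in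
/-- A pointed map to an open subset of a normed space factors, up to homotopy, through a polyhedron
whose vertices are the points of its domain. -/
theorem exists_factor_of_isOpen {X : PtdSpace.{u}} {E : Type u} [NormedAddCommGroup E]
    [NormedSpace ℝ E] {U : Set E} (hU : IsOpen U) {a : U} (h : Map X ⟨U, a⟩) :
    ∃ (K : AbstractSimplicialComplex X) (b : Polyhedron K) (q : X ⟶ ⟨Polyhedron K, b⟩)
      (f : (⟨Polyhedron K, b⟩ : PtdSpace.{u}) ⟶ ⟨U, a⟩), q ≫ f = homClass h := by
  let c : X → E := fun x => (h.1 x).1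
  have hcc : Continuous c := continuous_subtype_val.comp h.1.continuous
  choose ε hε hball using fun x => Metric.isOpen_iff.1 hU (c x) (h.1 x).2
  let W : X → Set (Set.range c) := fun x =>
    {y | dist y.1 (c x) < ε x / 3 ∧ (x = X.pt ∨ y.1 ≠ c X.pt)}
  have hW : ∀ x, IsOpen (W x) := fun x => by
    have hd : Continuous fun y : Set.range c => dist y.1 (c x) := by fun_prop
    refine IsOpen.inter (isOpen_lt hd continuous_const) ?_
    by_cases hx : x = X.pt
    · exact (Set.eq_univ_of_forall fun _ => Or.inl hx) ▸ isOpen_univ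
    · simp only [hx, false_or]
      exact isOpen_ne_fun continuous_subtype_val continuous_const
  have hcov : (Set.univ : Set (Set.range c)) ⊆ ⋃ x, W x := by
    rintro ⟨_, x, rfl⟩ -
    by_cases hx : c x = c X.pt
    · exact Set.mem_iUnion.2 ⟨X.pt, by simpa [hx] using hε X.pt, Or.inl rfl⟩
    · exact Set.mem_iUnion.2 ⟨x, by simpa using hε x, Or.inr hx⟩
  obtain ⟨φ, hφ⟩ := PartitionOfUnity.exists_isSubordinate isClosed_univ W hW hcov
  let y : X → Set.range c := fun x => ⟨c x, x, rfl⟩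
  have hy : Continuous y := hcc.subtype_mk _
  have hsupp : ∀ x z, z ∉ φ.fintsupport (y x) → φ z (y x) = 0 := fun x z hz => by
    by_contra h'
    exact hz (φ.finsupport_subset_fintsupport _ ((φ.mem_finsupport _).2 h'))
  -- Take `B` to be the ball of the vertex `m` with the largest `ε`: any other active vertex is
  -- within `ε z / 3 + ε m / 3 < ε m` of `c m`. The set `fintsupport` is used because it bounds the
  -- active vertices on a whole neighbourhood.
  have hhull : ∀ x, ∃ B ⊆ U, Convex ℝ B ∧ c x ∈ B ∧ c '' φ.fintsupport (y x) ⊆ B := fun x => by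
    have hd : ∀ z ∈ φ.fintsupport (y x), dist (c x) (c z) < ε z / 3 := fun z hz =>
      (hφ z ((φ.mem_fintsupport_iff _ z).1 hz)).1
    obtain ⟨z₀, hz₀⟩ := φ.exists_pos (Set.mem_univ (y x))
    have hz₀' : z₀ ∈ φ.fintsupport (y x) := by_contra fun h' => hz₀.ne' (hsupp x z₀ h')
    obtain ⟨m, hm, hmax⟩ := Finset.exists_max_image _ ε ⟨z₀, hz₀'⟩
    refine ⟨_, hball m, convex_ball _ _, ?_, ?_⟩
    · have := hd m hm
      have := hε m
      exact Metric.mem_ball.2 (by linarith)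
    · rintro _ ⟨z, hz, rfl⟩
      have h₁ := hd m hm
      have h₂ := hd z hz
      have h₃ := hmax z hz
      have h₄ := dist_triangle_left (c z) (c m) (c x)
      have h₅ := hε m
      exact Metric.mem_ball.2 (by linarith)
  have hcU : ∀ x, c x ∈ U := fun x => (h.1 x).2
  let q : C(X, Polyhedron (hullComplex c U hcU)) :=
    Polyhedron.baryMap (fun z x => φ z (y x)) (fun z => (φ z).continuous.comp hy)
      (fun z x => φ.nonneg z _) (fun x => φ.exists_pos (Set.mem_univ _)) (fun x => by
        obtain ⟨B, hBU, hB, -, hcB⟩ := hhull x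
        refine ⟨φ.fintsupport (y x), ⟨?_, (convexHull_min hcB hB).trans hBU⟩, ?_⟩
        · obtain ⟨z₀, hz₀⟩ := φ.exists_pos (Set.mem_univ (y x))
          exact ⟨z₀, by_contra fun h' => hz₀.ne' (hsupp x z₀ h')⟩
        · filter_upwards [hy.continuousAt.eventually (φ.eventually_fintsupport_subset (y x))]
            with x' hx' z hz
          exact hsupp x' z fun h' => hz (hx' h'))
  have hq : ∀ x z, (q x).1 z = φ z (y x) := fun x z => by
    change φ z (y x) / ∑ᶠ w, φ w (y x) = _
    rw [φ.sum_eq_one (Set.mem_univ _), div_one]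
  have hq0 : ∀ x, ∀ z ∉ φ.fintsupport (y x), (q x).1 z = 0 := fun x z hz => by
    rw [hq, hsupp x z hz]
  have hpt : ∀ z ∉ ({X.pt} : Finset X), (q X.pt).1 z = 0 := fun z hz => by
    rw [hq]
    by_contra h'
    have := (hφ z (subset_closure h')).2
    exact this.elim (fun h => hz (Finset.mem_singleton.2 h)) fun h => h rfl
  have heval : hullComplex.eval c U hcU (q X.pt) = a := by
    refine Subtype.ext ?_
    change ∑ᶠ v, (q X.pt).1 v • c v = a
    have h₁ := (q X.pt).sum_eq_one hpt
    rw [Finset.sum_singleton] at h₁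
    rw [hullComplex.sum_eq _ hpt, Finset.sum_singleton, h₁, one_smul]
    exact congrArg Subtype.val h.2
  -- The composite and `h` send `x` into the same convex set `B ⊆ U`, hence are joined by segments
  -- in `U`.
  refine ⟨hullComplex c U hcU, q X.pt, homClass ⟨q, rfl⟩,
    homClass ⟨hullComplex.eval c U hcU, heval⟩, homClass_eq_of_segment
      (f := ⟨(hullComplex.eval c U hcU).comp q, heval⟩) (g := h) fun x => ?_⟩
  obtain ⟨B, hBU, hB, hxB, hcB⟩ := hhull x
  exact (hB.segment_subset (convexHull_min hcB hB
    (hullComplex.sum_mem_convexHull (q x) (hq0 x))) hxB).trans hBU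

/-- A pointed polyhedron with vertices in `X` together with a morphism from `X` to it. -/
structure PolyUnder (X : PtdSpace.{u}) : Type u where
  cx : AbstractSimplicialComplex X
  pt : Polyhedron cx
  map : X ⟶ (⟨Polyhedron cx, pt⟩ : PtdSpace.{u})

/-! ### Filteredness of the category of polyhedra under a space -/

namespace PolyUnder

variable {X : PtdSpace.{u}}

/-- The underlying pointed space. -/
noncomputable def space (A : PolyUnder X) : PtdSpace.{u} := ⟨Polyhedron A.cx, A.pt⟩

/-- The structure morphism. -/
noncomputable def hom (A : PolyUnder X) : X ⟶ A.space := A.map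

theorem isHPol (A : PolyUnder X) : IsHPol A.space := ⟨X, A.cx, A.pt, ⟨Iso.refl _⟩⟩

/-- The morphisms `A ⟶ B` are the morphisms of `HTop_*` under `X` from `B` to `A`. -/
noncomputable instance : SmallCategory (PolyUnder X) where
  Hom A B := {f : B.space ⟶ A.space // B.hom ≫ f = A.hom}
  id A := ⟨𝟙 _, Category.comp_id _⟩
  comp f g := ⟨g.1 ≫ f.1, by rw [reassoc_of% g.2, f.2]⟩
  id_comp f := Subtype.ext (Category.comp_id _)
  comp_id f := Subtype.ext (Category.id_comp _)
  assoc f g h := Subtype.ext (Category.assoc _ _ _).symm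

theorem exists_factor {P : PtdSpace.{u}} (hP : IsOpenDominated P) (h : X ⟶ P) :
    ∃ (A : PolyUnder X) (f : A.space ⟶ P), A.hom ≫ f = h := by
  obtain ⟨E, _, _, U, hU, a, i, r, e⟩ := hP
  obtain ⟨k, hk⟩ := Quotient.exists_rep (h ≫ i)
  obtain ⟨K, b, q, f, hf⟩ := exists_factor_of_isOpen hU k
  refine ⟨⟨K, b, q⟩, f ≫ r, ?_⟩
  change q ≫ f ≫ r = h
  rw [reassoc_of% hf, show PtdSpace.homClass k = h ≫ i from hk, Category.assoc, e, Category.comp_id]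

-- The product of the two dominating open sets is again open in a normed space, so factoring the
-- single map into it factors both morphisms at once.
open PtdSpace in
theorem exists_factor_pair {P Q : PtdSpace.{u}} (hP : IsOpenDominated P) (hQ : IsOpenDominated Q)
    (h : X ⟶ P) (h' : X ⟶ Q) :
    ∃ (A : PolyUnder X) (f : A.space ⟶ P) (f' : A.space ⟶ Q), A.hom ≫ f = h ∧ A.hom ≫ f' = h' := by
  obtain ⟨E, _, _, U, hU, a, i, r, e⟩ := hP
  obtain ⟨E', _, _, U', hU', a', i', r', e'⟩ := hQ
  obtain ⟨k, hk⟩ := Quotient.exists_rep (h ≫ i)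
  obtain ⟨k', hk'⟩ := Quotient.exists_rep (h' ≫ i')
  have hk : homClass k = h ≫ i := hk
  have hk' : homClass k' = h' ≫ i' := hk'
  let w : (U ×ˢ U' : Set (E × E')) := ⟨(a.1, a'.1), a.2, a'.2⟩
  let m : Map X ⟨(U ×ˢ U' : Set (E × E')), w⟩ :=
    ⟨⟨fun x => ⟨((k.1 x).1, (k'.1 x).1), (k.1 x).2, (k'.1 x).2⟩, by fun_prop⟩,
      Subtype.ext (Prod.ext (congrArg Subtype.val k.2) (congrArg Subtype.val k'.2))⟩
  let π : Map ⟨(U ×ˢ U' : Set (E × E')), w⟩ ⟨U, a⟩ := ⟨⟨fun z => ⟨z.1.1, z.2.1⟩, by fun_prop⟩, rfl⟩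
  let π' : Map ⟨(U ×ˢ U' : Set (E × E')), w⟩ ⟨U', a'⟩ :=
    ⟨⟨fun z => ⟨z.1.2, z.2.2⟩, by fun_prop⟩, rfl⟩
  obtain ⟨K, b, q, f, hf⟩ := exists_factor_of_isOpen (hU.prod hU') m
  have hπ : homClass m ≫ homClass π = homClass k := rfl
  have hπ' : homClass m ≫ homClass π' = homClass k' := rfl
  refine ⟨⟨K, b, q⟩, f ≫ homClass π ≫ r, f ≫ homClass π' ≫ r', ?_, ?_⟩
  · change q ≫ f ≫ homClass π ≫ r = h
    rw [reassoc_of% hf, reassoc_of% hπ, hk, Category.assoc, e, Category.comp_id]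
  · change q ≫ f ≫ homClass π' ≫ r' = h'
    rw [reassoc_of% hf, reassoc_of% hπ', hk', Category.assoc, e', Category.comp_id]

open PtdSpace in
/-- A homotopy equalizer of maps between open subsets of normed spaces is realized by an open subset
of a normed space: a path of the target space, corrected so as to join the two images of a point, is
required to stay in the open subset. -/
theorem exists_homotopyEqualizer {E F : Type u} [NormedAddCommGroup E] [NormedSpace ℝ E]
    [NormedAddCommGroup F] [NormedSpace ℝ F] {U : Set E} (hU : IsOpen U) {U' : Set F}
    (hU' : IsOpen U') {a : U} {a' : U'} (f₀ f₁ : Map ⟨U, a⟩ ⟨U', a'⟩) (h : Map X ⟨U, a⟩)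
    (hh : homClass h ≫ homClass f₀ = homClass h ≫ homClass f₁) :
    ∃ (W : Set (E × C(I, F))) (_ : IsOpen W) (w : W) (k : Map X ⟨W, w⟩) (r : Map ⟨W, w⟩ ⟨U, a⟩),
      homClass k ≫ homClass r = homClass h ∧
      homClass r ≫ homClass f₀ = homClass r ≫ homClass f₁ := by
  obtain ⟨H⟩ : (h.comp f₀).1.HomotopicRel (h.comp f₁).1 {X.pt} := Quotient.exact hh
  have hf₀ : Continuous fun u : U => (f₀.1 u).1 := continuous_subtype_val.comp f₀.1.continuous
  have hf₁ : Continuous fun u : U => (f₁.1 u).1 := continuous_subtype_val.comp f₁.1.continuous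
  -- Requiring a path to join `f₀ u` to `f₁ u` is not an open condition. Instead an arbitrary path
  -- receives an affine correction of its ends, and only the corrected path is required to stay in
  -- `U'`.
  let G : (U × C(I, F)) × I → F := fun z => z.1.2 z.2 +
    ((1 - (z.2 : ℝ)) • ((f₀.1 z.1.1).1 - z.1.2 0) + (z.2 : ℝ) • ((f₁.1 z.1.1).1 - z.1.2 1))
  have hG : Continuous G := by
    have h₁ : Continuous fun z : (U × C(I, F)) × I => (f₀.1 z.1.1).1 :=
      hf₀.comp (continuous_fst.comp continuous_fst)
    have h₂ : Continuous fun z : (U × C(I, F)) × I => (f₁.1 z.1.1).1 :=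
      hf₁.comp (continuous_fst.comp continuous_fst)
    have h₃ : Continuous fun z : (U × C(I, F)) × I => z.1.2 z.2 := by fun_prop
    have h₄ : Continuous fun z : (U × C(I, F)) × I => z.1.2 0 := by fun_prop
    have h₅ : Continuous fun z : (U × C(I, F)) × I => z.1.2 1 := by fun_prop
    have h₆ : Continuous fun z : (U × C(I, F)) × I => (z.2 : ℝ) := by fun_prop
    exact h₃.add (((continuous_const.sub h₆).smul (h₁.sub h₄)).add (h₆.smul (h₂.sub h₅)))
  -- Compactness of `I` makes the condition for all `t` open in the compact-open topology.
  have hO : IsOpen {z : U × C(I, F) | ∀ t, G (z, t) ∈ U'} := by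
    have := (ContinuousMap.isOpen_setOfPred_mapsTo isCompact_univ hU').preimage
      (ContinuousMap.curry ⟨G, hG⟩).continuous
    simpa [Set.MapsTo, Set.preimage] using this
  let W : Set (E × C(I, F)) := {z | ∃ hz : z.1 ∈ U, ∀ t, G ((⟨z.1, hz⟩, z.2), t) ∈ U'}
  have hW : IsOpen W := by
    convert (hU.isOpenMap_subtype_val.prodMap IsOpenMap.id) _ hO using 1
    ext z
    constructor
    · rintro ⟨hz, h⟩
      exact ⟨(⟨z.1, hz⟩, z.2), h, rfl⟩
    · rintro ⟨z, h, rfl⟩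
      exact ⟨z.1.2, h⟩
  have hf₀a : f₀.1 a = a' := f₀.2
  have hf₁a : f₁.1 a = a' := f₁.2
  have hGa : ∀ t, G ((a, ContinuousMap.const I a'.1), t) = a' := fun t => by
    simp [G, hf₀a, hf₁a]
  let w : W := ⟨(a.1, ContinuousMap.const I a'.1), a.2, fun t => by rw [hGa]; exact a'.2⟩
  -- The lift of `h` uses the tracks of the given homotopy; their ends are already right, so the
  -- correction vanishes.
  let γ : C(X, C(I, F)) := ContinuousMap.curry ⟨fun z => (H (z.2, z.1)).1, by fun_prop⟩
  have hγ : ∀ x t, γ x t = (H (t, x)).1 := fun _ _ => rfl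
  have hGγ : ∀ x t, G ((h.1 x, γ x), t) = (H (t, x)).1 := fun x t => by
    have h₀ : (H (0, x)).1 = (f₀.1 (h.1 x)).1 := congrArg Subtype.val (H.apply_zero x)
    have h₁ : (H (1, x)).1 = (f₁.1 (h.1 x)).1 := congrArg Subtype.val (H.apply_one x)
    have e : G ((h.1 x, γ x), t) = (H (t, x)).1 +
      ((1 - (t : ℝ)) • ((f₀.1 (h.1 x)).1 - (H (0, x)).1) +
        (t : ℝ) • ((f₁.1 (h.1 x)).1 - (H (1, x)).1)) := rfl
    rw [e, h₀, h₁, sub_self, sub_self, smul_zero, smul_zero, add_zero, add_zero]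
  let k : Map X ⟨W, w⟩ :=
    ⟨⟨fun x => ⟨((h.1 x).1, γ x), (h.1 x).2, fun t => by
        have := hGγ x t
        change G ((h.1 x, γ x), t) ∈ U'
        rw [this]; exact (H (t, x)).2⟩, by fun_prop⟩, by
      have hx : h.1 X.pt = a := h.2
      refine Subtype.ext (Prod.ext (congrArg Subtype.val hx) (ContinuousMap.ext fun t => ?_))
      change (H (t, X.pt)).1 = a'.1
      rw [H.eq_fst t (Set.mem_singleton _)]
      change (f₀.1 (h.1 X.pt)).1 = a'.1
      rw [hx, hf₀a]⟩
  let r : Map ⟨W, w⟩ ⟨U, a⟩ := ⟨⟨fun z => ⟨z.1.1, z.2.1⟩, by fun_prop⟩, rfl⟩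
  -- The corrected path `G` is itself the homotopy from `f₀ ∘ r` to `f₁ ∘ r`.
  refine ⟨W, hW, w, k, r, rfl, Quotient.sound ⟨⟨⟨⟨fun z =>
    ⟨G ((r.1 z.2, z.2.1.2), z.1), z.2.2.2 z.1⟩, ?_⟩, fun z => ?_, fun z => ?_⟩, fun t z hz => ?_⟩⟩⟩
  · refine continuous_induced_rng.2 (hG.comp ?_)
    have := r.1.continuous
    fun_prop
  · exact Subtype.ext (by simp [G]; rfl)
  · exact Subtype.ext (by simp [G]; rfl)
  · rw [Set.mem_singleton_iff.1 hz]
    exact Subtype.ext ((hGa t).trans (congrArg Subtype.val hf₀a.symm))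

-- Domination replaces `f₀`, `f₁` by maps between open sets; the map of `X` into their homotopy
-- equalizer is then factored through a polyhedron. Both (E2) and the filteredness below rest on
-- this.
open PtdSpace in
theorem exists_factor_equalizing {P Q : PtdSpace.{u}} (hP : IsOpenDominated P)
    (hQ : IsOpenDominated Q) (f₀ f₁ : P ⟶ Q) (h : X ⟶ P) (hh : h ≫ f₀ = h ≫ f₁) :
    ∃ (A : PolyUnder X) (r : A.space ⟶ P), A.hom ≫ r = h ∧ r ≫ f₀ = r ≫ f₁ := by
  obtain ⟨E, _, _, U, hU, a, i, ρ, e⟩ := hP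
  obtain ⟨E', _, _, U', hU', a', i', ρ', e'⟩ := hQ
  obtain ⟨k, hk⟩ : ∃ k, homClass k = h ≫ i := Quotient.exists_rep (h ≫ i)
  obtain ⟨g₀, hg₀⟩ : ∃ k, homClass k = ρ ≫ f₀ ≫ i' := Quotient.exists_rep (ρ ≫ f₀ ≫ i')
  obtain ⟨g₁, hg₁⟩ : ∃ k, homClass k = ρ ≫ f₁ ≫ i' := Quotient.exists_rep (ρ ≫ f₁ ≫ i')
  obtain ⟨W, hW, w, m, r, hr, hr'⟩ := exists_homotopyEqualizer hU hU' g₀ g₁ k (by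
    rw [hk, hg₀, hg₁, Category.assoc, Category.assoc, reassoc_of% e, reassoc_of% e,
      reassoc_of% hh])
  obtain ⟨K, b, q, f, hf⟩ := exists_factor_of_isOpen hW m
  have hr'' : homClass r ≫ ρ ≫ f₀ = homClass r ≫ ρ ≫ f₁ := by
    rw [hg₀, hg₁] at hr'
    simpa [e'] using congrArg (· ≫ ρ') hr'
  refine ⟨⟨K, b, q⟩, f ≫ homClass r ≫ ρ, ?_, ?_⟩
  · change q ≫ f ≫ homClass r ≫ ρ = h
    rw [reassoc_of% hf, reassoc_of% hr, hk, Category.assoc, e, Category.comp_id]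
  · have : (f ≫ homClass r ≫ ρ) ≫ f₀ = (f ≫ homClass r ≫ ρ) ≫ f₁ := by
      simp only [Category.assoc, hr'']
    exact this

theorem isOpenDominated (A : PolyUnder X) : IsOpenDominated A.space := A.isHPol.isOpenDominated

instance : IsFiltered (PolyUnder X) where
  nonempty := by
    obtain ⟨A, -⟩ := exists_factor (Polyhedron.isOpenDominated (K := (⊤ : AbstractSimplicialComplex X))
      (Polyhedron.simplexMap _ ⟨{X.pt}, AbstractSimplicialComplex.singleton_mem _ _⟩
        ⟨Pi.single ⟨X.pt, Finset.mem_singleton_self _⟩ 1, single_mem_stdSimplex ℝ _⟩))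
      (PtdSpace.homClass ⟨ContinuousMap.const _ _, rfl⟩)
    exact ⟨A⟩
  cocone_objs A B := by
    obtain ⟨C, f, g, hf, hg⟩ :=
      exists_factor_pair A.isOpenDominated B.isOpenDominated A.hom B.hom
    exact ⟨C, ⟨f, hf⟩, ⟨g, hg⟩, trivial⟩
  cocone_maps A B f g := by
    obtain ⟨C, r, hr, e⟩ := exists_factor_equalizing B.isOpenDominated A.isOpenDominated f.1 g.1 B.hom
      (f.2.trans g.2.symm)
    exact ⟨C, ⟨r, hr⟩, Subtype.ext e⟩

end PolyUnder

/-- Every pointed space has an `HPol_*`-expansion. -/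
theorem HPolExpansion.nonempty (X : PtdSpace.{u}) : Nonempty (HPolExpansion X) := by
  obtain ⟨Λ, _, _, _, F, hF⟩ := IsFiltered.exists_directed (PolyUnder X)
  obtain ⟨h₁, h₂⟩ := F.final_iff_of_isFiltered.1 hF
  refine ⟨{
    sys := {
      Idx := Λ
      obj := fun l => (F.obj l).space
      bond := fun h => (F.map (homOfLE h)).1
      bond_refl := fun l => congrArg Subtype.val (F.map_id l)
      bond_comp := fun h h' =>
        (congrArg Subtype.val (F.map_comp (homOfLE h) (homOfLE h'))).symm }
    isHPol := fun l => (F.obj l).isHPol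
    proj := fun l => (F.obj l).hom
    proj_bond := fun h => (F.map (homOfLE h)).2
    E1 := fun P hP h => ?_
    E2 := fun P hP l f₀ f₁ h => ?_ }⟩
  · obtain ⟨A, f, hf⟩ := PolyUnder.exists_factor hP.isOpenDominated h
    obtain ⟨l, ⟨s⟩⟩ := h₁ A
    exact ⟨l, s.1 ≫ f, by rw [reassoc_of% s.2, hf]⟩
  · obtain ⟨A, r, hr, e⟩ := PolyUnder.exists_factor_equalizing (F.obj l).isOpenDominated
      hP.isOpenDominated f₀ f₁ (F.obj l).hom h
    obtain ⟨l₁, ⟨s⟩⟩ := h₁ A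
    obtain ⟨l₂, hl, hl₁⟩ := exists_ge_ge l l₁
    let r' : F.obj l ⟶ A := ⟨r, hr⟩
    -- The bonding arrow to `l₂` and the arrow passing through `A` need not agree; finality makes
    -- them agree at some `l₃`. The bonding morphism to `l₃` then factors through `r`, on which `f₀`
    -- and `f₁` coincide.
    obtain ⟨l₃, t, ht⟩ := h₂ (F.map (homOfLE hl)) (r' ≫ s ≫ F.map (homOfLE hl₁))
    refine ⟨l₃, hl.trans (leOfHom t), ?_⟩
    have e' : (F.map (homOfLE (hl.trans (leOfHom t)))).1 =
        ((F.map t).1 ≫ (F.map (homOfLE hl₁)).1 ≫ s.1) ≫ r := by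
      rw [← homOfLE_comp hl (leOfHom t), F.map_comp]
      refine (congrArg Subtype.val ht).trans ?_
      change (F.map t).1 ≫ ((F.map (homOfLE hl₁)).1 ≫ s.1) ≫ r = _
      simp only [Category.assoc]
    change (F.map (homOfLE (hl.trans (leOfHom t)))).1 ≫ f₀ =
      (F.map (homOfLE (hl.trans (leOfHom t)))).1 ≫ f₁
    rw [e']
    exact (Category.assoc _ _ _).trans ((congrArg _ e).trans (Category.assoc _ _ _).symm)

/-! ## The coarse shape homotopy group as an inverse limit -/

namespace HPolExpansion

variable {X : PtdSpace.{u}}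

/-- The projection of an expansion to one of its terms, as a morphism of inverse systems. -/
def toTerm (p : HPolExpansion X) (l : p.sys.Idx) : ProMor p.sys (rud (p.sys.obj l)) where
  idx _ := l
  hom _ := 𝟙 _
  comm _ := ⟨l, le_refl l, le_refl l,
    congrArg (p.sys.bond (le_refl l) ≫ ·) (Category.comp_id (𝟙 (p.sys.obj l)))⟩

theorem isLift_toTerm (p : HPolExpansion X) (l : p.sys.Idx) :
    IsLift p (ofHPol _ (p.isHPol l)) (p.proj l) (p.toTerm l) := fun _ => rfl

/-- A morphism of spaces, as a morphism of rudimentary systems. -/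
def _root_.InvSystem.rudMor {C : Type v} [Category.{u} C] {S T : C} (f : S ⟶ T) :
    ProMor (rud S) (rud T) where
  idx _ := PUnit.unit
  hom _ := f
  comm _ := ⟨PUnit.unit, le_refl _, le_refl _,
    congrArg (𝟙 S ≫ ·) (Category.comp_id f : f ≫ 𝟙 T = f)⟩

theorem isLift_rudMor {P Q : PtdSpace.{u}} (hP : IsHPol P) (hQ : IsHPol Q) (f : P ⟶ Q) :
    IsLift (ofHPol P hP) (ofHPol Q hQ) f (rudMor f) := fun _ =>
  (Category.id_comp f : 𝟙 P ≫ f = f).trans (Category.comp_id f : f ≫ 𝟙 Q = f).symm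

theorem J_id_of_isLift (p : HPolExpansion X) {i : ProMor p.sys p.sys} (hi : IsLift p p (𝟙 X) i) :
    i.J = 𝟙 p.sys := by
  let j : ProMor p.sys p.sys := 
    ⟨id, fun _ => 𝟙 _, fun {μ μ'} h => ⟨μ', h, le_refl _, by simp [p.sys.bond_refl]⟩⟩
  have hj : IsLift p p (𝟙 X) j := fun μ => by simp [j]
  exact lift_unique hi hj

end HPolExpansion

namespace CoarsePi

variable {k : ℕ} {X Y Z : PtdSpace.{u}}

open HPolExpansion

/-- A coarse shape morphism is determined by its representative over one expansion. -/
theorem ext_rep (p : HPolExpansion X) {F G : CoarsePi k X} (h : F.rep p = G.rep p) : F = G := by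
  refine CoarsePi.ext (funext fun q => ?_)
  obtain ⟨i, hi⟩ := p.exists_lift q (𝟙 X)
  rw [← F.compat p q i hi, ← G.compat p q i hi, h]

/-- The representative is transported along chosen lifts of the identity; uniqueness of lifts makes
the family compatible. -/
theorem exists_rep_eq (p : HPolExpansion X) (a : rud (sphere.{u} k) ⟶ p.sys) :
    ∃ F : CoarsePi k X, F.rep p = a := by
  choose i hi using fun q => p.exists_lift q (𝟙 X)
  refine ⟨⟨fun q => a ≫ (i q).J, fun q q' j hj => ?_⟩, ?_⟩
  · rw [Category.assoc, ← ProMor.J_comp]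
    exact congrArg (a ≫ ·) (lift_unique (by simpa using (hi q).comp hj) (hi q'))
  · change a ≫ (i p).J = a
    rw [J_id_of_isLift p (hi p), Category.comp_id]

variable [NeZero k]

theorem push_id (p : HPolExpansion X) (F : CoarsePi k X) : push p (𝟙 X) F = F := by
  refine CoarsePi.ext (funext fun q => ?_)
  obtain ⟨i, hi⟩ := p.exists_lift q (𝟙 X)
  rw [push_rep p q _ F hi, F.compat p q i hi]

theorem push_push (p : HPolExpansion X) (q : HPolExpansion Y) (f : X ⟶ Y) (g : Y ⟶ Z)
    (F : CoarsePi k X) : push q g (push p f F) = push p (f ≫ g) F := by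
  refine CoarsePi.ext (funext fun r => ?_)
  obtain ⟨i, hi⟩ := p.exists_lift q f
  obtain ⟨j, hj⟩ := q.exists_lift r g
  rw [push_rep q r g _ hj, push_rep p q f F hi, push_rep p r _ F (hi.comp hj), ProMor.J_comp,
    Category.assoc]

/-! ### Topology and comparison with the inverse limit -/

theorem isOpen_basicSet (p : HPolExpansion X) (l : p.sys.Idx) (F : CoarsePi k X) :
    IsOpen (basicSet p l F) :=
  iInf_le (fun p : HPolExpansion X => TopologicalSpace.generateFrom
    {U | ∃ (l : p.sys.Idx) (F : CoarsePi k X), U = basicSet p l F}) p _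
    (TopologicalSpace.isOpen_generateFrom_of_mem ⟨l, F, rfl⟩)

/-- In the rudimentary expansion the only projection is the identity, so the basic set of `F` is
`{F}`. -/
theorem discreteTopology_of_isHPol (hX : IsHPol X) : DiscreteTopology (CoarsePi k X) := by
  refine discreteTopology_iff_isOpen_singleton.2 fun F => ?_
  convert isOpen_basicSet (ofHPol X hX) PUnit.unit F
  ext G
  change G = F ↔ push _ (𝟙 X) F = push _ (𝟙 X) G
  rw [push_id, push_id, eq_comm]

theorem isOpen_push_preimage (p : HPolExpansion X) (l : p.sys.Idx)
    (S : Set (CoarsePi k (p.sys.obj l))) : IsOpen {F : CoarsePi k X | push p (p.proj l) F ∈ S} := by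
  refine isOpen_iff_forall_mem_open.2 fun F hF => ⟨basicSet p l F, fun G hG => ?_,
    isOpen_basicSet p l F, rfl⟩
  have hG : push p (p.proj l) F = push p (p.proj l) G := hG
  change push p (p.proj l) G ∈ S
  rw [← hG]
  exact hF

/-- Representatives over the terms of an expansion, in terms of components. -/
theorem push_proj_rep (p : HPolExpansion X) (l : p.sys.Idx) (F : CoarsePi k X)
    {f : SMor (rud (sphere.{u} k)) p.sys} (hf : F.rep p = f.cls)
    {g : SMor (rud (sphere.{u} k)) (rud (p.sys.obj l))} :
    (push p (p.proj l) F).rep (ofHPol _ (p.isHPol l)) = g.cls ↔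
      ∃ n : ℕ, ∀ m, n ≤ m → SphereMor.comps f m l = SphereMor.comps g m PUnit.unit := by
  rw [push_rep p _ _ F (p.isLift_toTerm l), hf]
  refine Quotient.eq.trans ((SphereMor.equiv_iff _ _).trans ⟨fun h => ?_, fun h _ => ?_⟩)
  · obtain ⟨n, e⟩ := h PUnit.unit
    exact ⟨n, fun m hm => (Category.comp_id (SphereMor.comps f m l)).symm.trans (e m hm)⟩
  · obtain ⟨n, e⟩ := h
    exact ⟨n, fun m hm => (Category.comp_id (SphereMor.comps f m l)).trans (e m hm)⟩

theorem pushBond_proj (p : HPolExpansion X) {l l' : p.sys.Idx} (h : l ≤ l') (F : CoarsePi k X) :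
    p.pushBond k h (push p (p.proj l') F) = push p (p.proj l) F := by
  rw [HPolExpansion.pushBond, push_push, p.proj_bond]

theorem pushBond_refl (p : HPolExpansion X) (l : p.sys.Idx) :
    p.pushBond k (le_refl l) = MonoidHom.id _ := by
  ext1 F
  rw [HPolExpansion.pushBond, p.sys.bond_refl, push_id, MonoidHom.id_apply]

theorem pushBond_comp (p : HPolExpansion X) {a b c : p.sys.Idx} (h : a ≤ b) (h' : b ≤ c) :
    (p.pushBond k h).comp (p.pushBond k h') = p.pushBond k (h.trans h') := by
  ext1 F
  simp only [HPolExpansion.pushBond, MonoidHom.comp_apply]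
  rw [push_push, p.sys.bond_comp]

/-- The map `F ↦ (p_λ ∘ F)_λ` to the inverse limit. -/
noncomputable def toLimit (p : HPolExpansion X) : CoarsePi k X →*
    groupLimit (fun l => CoarsePi k (p.sys.obj l)) (fun h => p.pushBond k h) where
  toFun F := ⟨fun l => push p (p.proj l) F, fun _ _ h => pushBond_proj p h F⟩
  map_one' := Subtype.ext (funext fun _ => map_one _)
  map_mul' F G := Subtype.ext (funext fun _ => map_mul _ F G)

/-- Equivalence in pro* is tested at each index separately, with its own bound on `n`, so agreement
of all projections suffices. -/
theorem toLimit_injective (p : HPolExpansion X) :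
    Function.Injective (toLimit (k := k) p) := by
  intro F G h
  refine ext_rep p ?_
  obtain ⟨f, hf⟩ : ∃ f : SMor _ _, f.cls = F.rep p := Quotient.exists_rep (F.rep p)
  obtain ⟨g, hg⟩ : ∃ g : SMor _ _, g.cls = G.rep p := Quotient.exists_rep (G.rep p)
  rw [← hf, ← hg]
  refine Quotient.sound ((SphereMor.equiv_iff _ _).2 fun l => ?_)
  have hl : push p (p.proj l) F = push p (p.proj l) G := congrFun (congrArg Subtype.val h) l
  obtain ⟨c, hc⟩ : ∃ c : SMor _ _, c.cls = (push p (p.proj l) F).rep (ofHPol _ (p.isHPol l)) :=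
    Quotient.exists_rep _
  obtain ⟨n, e⟩ := (push_proj_rep p l F hf.symm).1 hc.symm
  rw [hl] at hc
  obtain ⟨n', e'⟩ := (push_proj_rep p l G hg.symm).1 hc.symm
  exact ⟨max n n', fun m hm =>
    (e m (le_of_max_le_left hm)).trans (e' m (le_of_max_le_right hm)).symm⟩

/-- Sequences are chosen independently for each `λ`. Compatibility of the thread says that they
match along each bonding morphism for large `n`, which is exactly the coherence required in pro*. -/
theorem toLimit_surjective (p : HPolExpansion X) :
    Function.Surjective (toLimit (k := k) p) := by
  rintro ⟨a, ha⟩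
  have hex : ∀ l, ∃ c : SMor (rud (sphere.{u} k)) (rud (p.sys.obj l)),
      c.cls = (a l).rep (ofHPol _ (p.isHPol l)) := fun l => Quotient.exists_rep _
  choose c hc using hex
  let f : SMor (rud (sphere.{u} k)) p.sys :=
    SphereMor.ofComps (fun n l => SphereMor.comps (c l) n PUnit.unit) fun {l l'} h => by
      have e : ((a l').rep (ofHPol _ (p.isHPol l'))) ≫ (rudMor (p.sys.bond h)).J
          = (a l).rep (ofHPol _ (p.isHPol l)) := by
        rw [← ha l l' h]
        exact (push_rep _ _ _ (a l') (isLift_rudMor _ _ _)).symm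
      rw [← hc, ← hc] at e
      exact (SphereMor.equiv_iff _ _).1 (Quotient.exact e) PUnit.unit
  obtain ⟨F, hF⟩ := exists_rep_eq p f.cls
  refine ⟨F, Subtype.ext (funext fun l => ext_rep (ofHPol _ (p.isHPol l)) ?_)⟩
  change (push p (p.proj l) F).rep _ = (a l).rep _
  rw [← hc l]
  exact (push_proj_rep p l F hF).2 ⟨0, fun _ _ => rfl⟩

theorem continuous_toLimit (p : HPolExpansion X) : Continuous (toLimit (k := k) p) := by
  refine continuous_induced_rng.2 (continuous_pi fun l => ?_)
  exact continuous_def.2 fun S _ => isOpen_push_preimage p l S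

/-- The topology involves all expansions `q`, not only `p`. By (E1), `q_l` is `f ∘ p_m`, so
membership in the basic set depends only on the coordinate `m`, whose group is discrete. -/
theorem isOpen_toLimit_preimage_basicSet (p q : HPolExpansion X) (l : q.sys.Idx) (F : CoarsePi k X) :
    ∃ S, IsOpen S ∧ basicSet q l F = toLimit p ⁻¹' S := by
  obtain ⟨m, f, hf⟩ := p.E1 _ (q.isHPol l) (q.proj l)
  have := discreteTopology_of_isHPol (k := k) (p.isHPol m)
  let T : Set (CoarsePi k (p.sys.obj m)) :=
    {y | push (ofHPol _ (p.isHPol m)) f y = push q (q.proj l) F}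
  have hc : Continuous fun a : groupLimit (fun l => CoarsePi k (p.sys.obj l))
      (fun h => p.pushBond k h) => a.1 m := (continuous_apply m).comp continuous_subtype_val
  refine ⟨_, (isOpen_discrete T).preimage hc, ?_⟩
  ext G
  change push q (q.proj l) F = push q (q.proj l) G ↔
    push _ f (push p (p.proj m) G) = push q (q.proj l) F
  rw [push_push, hf, push_eq p q, eq_comm]

/-- The isomorphism of topological groups to the inverse limit over an expansion. -/
noncomputable def limitEquiv (p : HPolExpansion X) : CoarsePi k X ≃ₜ*
    groupLimit (fun l => CoarsePi k (p.sys.obj l)) (fun h => p.pushBond k h) :=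
  { MulEquiv.ofBijective (toLimit p) ⟨toLimit_injective p, toLimit_surjective p⟩ with
    continuous_toFun := continuous_toLimit p
    continuous_invFun := by
      let e := Equiv.ofBijective (toLimit (k := k) p) ⟨toLimit_injective p, toLimit_surjective p⟩
      refine continuous_iInf_rng.2 fun q => continuous_generateFrom_iff.2 ?_
      rintro _ ⟨l, F, rfl⟩
      obtain ⟨S, hS, h⟩ := isOpen_toLimit_preimage_basicSet p q l F
      rw [h]
      convert hS
      ext a
      exact iff_of_eq (congrArg (· ∈ S) (e.apply_symm_apply a)) }

end CoarsePi

/-- Reindexing of an inverse limit along `ULift`. -/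
def groupLimitULift {Λ : Type u} [Preorder Λ] (H : Λ → Type v) [∀ i, Group (H i)]
    [∀ i, TopologicalSpace (H i)] (φ : ∀ {i j : Λ}, i ≤ j → H j →* H i) :
    groupLimit H φ ≃ₜ* groupLimit (fun i : ULift.{v} Λ => H i.down) (fun h => φ h) where
  toFun a := ⟨fun i => a.1 i.down, fun i j h => a.2 i.down j.down h⟩
  invFun a := ⟨fun i => a.1 ⟨i⟩, fun i j h => a.2 ⟨i⟩ ⟨j⟩ h⟩
  left_inv _ := rfl
  right_inv _ := rfl
  map_mul' _ _ := rfl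
  continuous_toFun := continuous_induced_rng.2 (continuous_pi fun i =>
    (continuous_apply i.down).comp continuous_subtype_val)
  continuous_invFun := continuous_induced_rng.2 (continuous_pi fun i =>
    (continuous_apply (ULift.up i)).comp continuous_subtype_val)

theorem mainTheorem4 (k : ℕ) [NeZero k] (X : PtdSpace.{u}) :
    (∀ p : HPolExpansion X,
      (∀ l, DiscreteTopology (CoarsePi k (p.sys.obj l))) ∧
      ∃ e : CoarsePi k X ≃ₜ*
          groupLimit (fun l => CoarsePi k (p.sys.obj l)) (fun h => p.pushBond k h),
        ∀ (F : CoarsePi k X) (l : p.sys.Idx),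
          (e F : ∀ l, CoarsePi k (p.sys.obj l)) l = CoarsePi.push p (p.proj l) F) ∧
    IsTopologicalGroup (CoarsePi k X) ∧
    IsProdiscrete (CoarsePi k X) ∧
    T2Space (CoarsePi k X) := by
  obtain ⟨p⟩ := HPolExpansion.nonempty X
  have hd : ∀ l, DiscreteTopology (CoarsePi k (p.sys.obj l)) := fun l =>
    CoarsePi.discreteTopology_of_isHPol (p.isHPol l)
  let e := CoarsePi.limitEquiv (k := k) p
  refine ⟨fun p => ⟨fun l => CoarsePi.discreteTopology_of_isHPol (p.isHPol l),
    CoarsePi.limitEquiv p, fun _ _ => rfl⟩, ?_, ?_, ?_⟩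
  -- The limit is a subgroup of a product of discrete groups; the topological group structure, and
  -- below the Hausdorff property, transfer along `e`.
  · exact e.toHomeomorph.isInducing.topologicalGroup e.toMonoidHom
  · have : IsDirectedOrder (ULift.{u + 1} p.sys.Idx) := ⟨fun a b => by
      obtain ⟨c, hac, hbc⟩ := exists_ge_ge a.down b.down
      exact ⟨⟨c⟩, hac, hbc⟩⟩
    -- `IsProdiscrete` wants the index set in the universe of the group, which is one above that of
    -- the indices of `p`.
    exact ⟨ULift.{u + 1} p.sys.Idx, inferInstance, inferInstance, inferInstance,
      fun i => CoarsePi k (p.sys.obj i.down), fun _ => inferInstance, fun _ => inferInstance,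
      fun i => hd i.down, fun h => p.pushBond k h, fun i => CoarsePi.pushBond_refl p i.down,
      fun h h' => CoarsePi.pushBond_comp p h h',
      ⟨e.trans (groupLimitULift (fun l => CoarsePi k (p.sys.obj l)) fun h => p.pushBond k h)⟩⟩
  · exact e.toHomeomorph.symm.t2Space
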